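/- Let $X$ be a real Banach lattice that is order continuous, i.e. every decreasing sequence of positive elements of $X$ converges in norm. **(Real case.)** For $x,y\in X$ put $b(x,y)=|x|\wedge y_+-|x|\wedge y_-$, where $y_+=y\vee 0$ and $y_-=(-y)\vee 0$. A band is a set of the form $A^\perp=\{x\in X:\ |x|\wedge|a|=0 \text{ for all } a\in A\}$ with $A\subseteq X$. A sign change on $X$ is an isometry of the form $U=2P-I$, where $P$ is a band projection, i.e. the projection onto a band $B$ along $B^\perp$, where $X=B\oplus B^\perp$. Then for every closed linear subspace $E$ of $X$ the following are equivalent: 1. there is a sign change $U$ on $X$ such that $U(E)$ is a closed vector sublattice of $X$ (a linear subspace closed under $\vee$ and $\wedge$); 2. $b(x,y)\in E$ for all $x,y\in E$. **(Complex case.)** Let $X_{\mathbb C}=X+iX$ be the complexification of $X$, with modulus $|a+ib|=\bigvee_{\theta}\big((\cos\theta)a+(\sin\theta)b\big)\in X$ and norm $\|z\|=\|\,|z|\,\|_X$; every order continuous complex Banach lattice is of this form. For $y\in X_{\mathbb C}$ let $\mathcal I(y)$ be the closed ideal generated by $y$, that is, the closure of $\{z\in X_{\mathbb C}:\ |z|\le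 n|y| \text{ for some } n\in\mathbb N\}$, and let $S_y$ be the sign of $y$, that is, the unique complex linear operator $S_y:\mathcal I(y)\to\mathcal I(y)$ with $|S_yz|=|z|$ for all $z\in\mathcal I(y)$ and $S_y|y|=y$. For $x,y\in X_{\mathbb C}$ put $b(x,y)=S_y(|x|\wedge|y|)$. A complex sign change is a complex linear map $U:X_{\mathbb C}\to X_{\mathbb C}$ with $|Uz|=|z|$ for all $z\in X_{\mathbb C}$. Then for every closed complex linear subspace $E$ of $X_{\mathbb C}$ the following are equivalent: 1. there is a complex sign change $U$ such that $U(E)$ is a closed complex vector sublattice of $X_{\mathbb C}$, i.e. $U(E)=Y+iY$ for some closed vector sublattice $Y$ of $X$; 2. $b(x,y)\in E$ for all $x,y\in E$. -/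

import Mathlib

open Filter Topology

namespace BLat

/-! ### Real Banach lattices -/

section Real

variable {X : Type*} [NormedAddCommGroup X] [Lattice X]

/-- Order continuity: every decreasing sequence of positive elements converges in norm. -/
def IsOrderContinuous (X : Type*) [NormedAddCommGroup X] [Lattice X] : Prop :=
  ∀ u : ℕ → X, Antitone u → (∀ n, 0 ≤ u n) → ∃ l : X, Tendsto u atTop (𝓝 l)

/-- The set of all elements that are disjoint from every element of `A`. -/
def disjointCompl (A : Set X) : Set X := {x | ∀ y ∈ A, |x| ⊓ |y| = 0}

/-- A band is a set of the form `A^⊥`. -/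
def IsBand (B : Set X) : Prop := ∃ A : Set X, B = disjointCompl A

/-- `b(x,y) = |x| ∧ y₊ - |x| ∧ y₋`. -/
def laceyReal (x y : X) : X := |x| ⊓ y⁺ - |x| ⊓ y⁻

variable [NormedSpace ℝ X]

/-- A linear subspace closed under the two lattice operations. -/
def IsVectorSublattice (E : Submodule ℝ X) : Prop :=
  ∀ x ∈ E, ∀ y ∈ E, x ⊔ y ∈ E ∧ x ⊓ y ∈ E

/-- `P` is the projection onto a band `B` along `B^⊥` (so that `X = B ⊕ B^⊥`). -/
def IsBandProjection (P : X →ₗ[ℝ] X) : Prop :=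
  ∃ B : Set X, IsBand B ∧ ∀ x, P x ∈ B ∧ x - P x ∈ disjointCompl B

/-- A sign change is an isometry of the form `2P - I` with `P` a band projection. -/
def IsSignChange (U : X →ₗ[ℝ] X) : Prop :=
  Isometry U ∧ ∃ P : X →ₗ[ℝ] X, IsBandProjection P ∧ U = (2 : ℝ) • P - LinearMap.id

/-- Some sign change on `X` maps `E` onto a closed vector sublattice of `X`. -/
def IsClosedSublatticeUpToSignChange (E : Submodule ℝ X) : Prop :=
  ∃ U : X →ₗ[ℝ] X, IsSignChange U ∧
    IsClosed (E.map U : Set X) ∧ IsVectorSublattice (E.map U)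

end Real

/-! ### The complexification of a real Banach lattice -/

/-- The elements `a + i b` of the complexification `X + iX`. -/
@[ext]
structure Complexification (X : Type*) where
  re : X
  im : X

namespace Complexification

section Algebra

variable {X : Type*} [AddCommGroup X]

instance : Zero (Complexification X) := ⟨⟨0, 0⟩⟩
instance : Add (Complexification X) := ⟨fun z w => ⟨z.re + w.re, z.im + w.im⟩⟩
instance : Neg (Complexification X) := ⟨fun z => ⟨-z.re, -z.im⟩⟩
instance : Sub (Complexification X) := ⟨fun z w => ⟨z.re - w.re, z.im - w.im⟩⟩

@[simp] theorem zero_re : (0 : Complexification X).re = 0 := rfl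
@[simp] theorem zero_im : (0 : Complexification X).im = 0 := rfl
@[simp] theorem add_re (z w : Complexification X) : (z + w).re = z.re + w.re := rfl
@[simp] theorem add_im (z w : Complexification X) : (z + w).im = z.im + w.im := rfl
@[simp] theorem neg_re (z : Complexification X) : (-z).re = -z.re := rfl
@[simp] theorem neg_im (z : Complexification X) : (-z).im = -z.im := rfl
@[simp] theorem sub_re (z w : Complexification X) : (z - w).re = z.re - w.re := rfl
@[simp] theorem sub_im (z w : Complexification X) : (z - w).im = z.im - w.im := rfl

instance : AddCommGroup (Complexification X) where
  add_assoc z w v := by ext <;> simp [add_assoc]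
  zero_add z := by ext <;> simp
  add_zero z := by ext <;> simp
  nsmul := nsmulRec
  zsmul := zsmulRec
  neg_add_cancel z := by ext <;> simp
  add_comm z w := by ext <;> simp [add_comm]
  sub_eq_add_neg z w := by ext <;> simp [sub_eq_add_neg]

/-- The inclusion of `X` as the real part of its complexification. -/
def ofReal (x : X) : Complexification X := ⟨x, 0⟩

variable [Module ℝ X]

instance : SMul ℂ (Complexification X) :=
  ⟨fun c z => ⟨c.re • z.re - c.im • z.im, c.re • z.im + c.im • z.re⟩⟩

@[simp] theorem smul_re (c : ℂ) (z : Complexification X) :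
    (c • z).re = c.re • z.re - c.im • z.im := rfl
@[simp] theorem smul_im (c : ℂ) (z : Complexification X) :
    (c • z).im = c.re • z.im + c.im • z.re := rfl

instance : Module ℂ (Complexification X) where
  one_smul z := by ext <;> simp
  mul_smul c d z := by ext <;> simp <;> module
  smul_zero c := by ext <;> simp
  smul_add c z w := by ext <;> simp <;> module
  add_smul c d z := by ext <;> simp <;> module
  zero_smul z := by ext <;> simp

end Algebra

section Modulus

variable {X : Type*} [NormedAddCommGroup X] [NormedSpace ℝ X]

/-- The real element `(cos θ) a + (sin θ) b`, for `z = a + i b`. -/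
noncomputable def rot (z : Complexification X) (θ : ℝ) : X :=
  Real.cos θ • z.re + Real.sin θ • z.im

variable [Lattice X]

theorem smul_le_abs_smul [IsOrderedAddMonoid X] [IsOrderedModule ℝ X] (t : ℝ) (x : X) : t • x ≤ |t| • |x| := by
  rcases le_total 0 t with h | h
  · rw [abs_of_nonneg h]
    exact smul_le_smul_of_nonneg_left (le_abs_self x) h
  · rw [abs_of_nonpos h, ← neg_smul_neg]
    exact smul_le_smul_of_nonneg_left (neg_le_abs x) (neg_nonneg.2 h)

variable [IsOrderedAddMonoid X] [IsOrderedModule ℝ X]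

theorem rot_le_rot_add (z : Complexification X) (s t : ℝ) :
    rot z s ≤ rot z t + |s - t| • (|z.re| + |z.im|) := by
  have h1 : |Real.cos s - Real.cos t| ≤ |s - t| := by
    simpa [Real.dist_eq] using Real.lipschitzWith_cos.dist_le_mul s t
  have h2 : |Real.sin s - Real.sin t| ≤ |s - t| := by
    simpa [Real.dist_eq] using Real.lipschitzWith_sin.dist_le_mul s t
  have e : rot z s = rot z t +
      ((Real.cos s - Real.cos t) • z.re + (Real.sin s - Real.sin t) • z.im) := by
    simp only [rot]; module
  rw [e, smul_add]
  gcongr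
  · exact (smul_le_abs_smul _ _).trans (smul_le_smul_of_nonneg_right h1 (abs_nonneg _))
  · exact (smul_le_abs_smul _ _).trans (smul_le_smul_of_nonneg_right h2 (abs_nonneg _))

variable [HasSolidNorm X] [CompleteSpace X]

/-- The supremum of all `(cos θ) a + (sin θ) b` exists in every Banach lattice. -/
theorem exists_isLUB_rot (z : Complexification X) : ∃ m, IsLUB (Set.range (rot z)) m := by
  set e : X := |z.re| + |z.im| with he
  have he0 : 0 ≤ e := add_nonneg (abs_nonneg _) (abs_nonneg _)
  have hne : ∀ n : ℕ, (Finset.range (7 * (n + 1) + 1)).Nonempty := fun n => by simp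
  let u : ℕ → X := fun n =>
    (Finset.range (7 * (n + 1) + 1)).sup' (hne n) fun k => rot z ((k : ℝ) / (n + 1))
  have hub : ∀ n θ, rot z θ ≤ u n + (1 / ((n : ℝ) + 1)) • e := by
    intro n θ
    have hper : Function.Periodic (rot z) (2 * Real.pi) := fun t => by simp [rot]
    obtain ⟨t, ht, hθ⟩ := hper.exists_mem_Ico₀ Real.two_pi_pos θ
    rw [hθ]
    have hn : (0 : ℝ) < (n : ℝ) + 1 := by positivity
    have ht7 : t < 7 := by linarith [ht.2, Real.pi_lt_d2]
    have ht0 : 0 ≤ t * ((n : ℝ) + 1) := mul_nonneg ht.1 hn.le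
    set k := ⌊t * ((n : ℝ) + 1)⌋₊ with hk
    have hk1 : (k : ℝ) ≤ t * ((n : ℝ) + 1) := Nat.floor_le ht0
    have hk2 : t * ((n : ℝ) + 1) < k + 1 := Nat.lt_floor_add_one _
    have hmem : k ∈ Finset.range (7 * (n + 1) + 1) := by
      rw [Finset.mem_range, Nat.lt_succ_iff]
      have : (k : ℝ) ≤ ((7 * (n + 1) : ℕ) : ℝ) := by push_cast; nlinarith
      exact_mod_cast this
    have hd : |t - (k : ℝ) / (n + 1)| ≤ 1 / ((n : ℝ) + 1) := by
      have h3 : t - (k : ℝ) / (n + 1) = (t * ((n : ℝ) + 1) - k) / (n + 1) := by field_simp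
      rw [h3, abs_of_nonneg (div_nonneg (by linarith) hn.le)]
      gcongr
      linarith
    refine (rot_le_rot_add z t ((k : ℝ) / (n + 1))).trans (add_le_add ?_ ?_)
    · exact Finset.le_sup' (fun k : ℕ => rot z ((k : ℝ) / (n + 1))) hmem
    · exact smul_le_smul_of_nonneg_right hd he0
  have hle : ∀ n m, u m ≤ u n + (1 / ((n : ℝ) + 1)) • e := fun n m =>
    Finset.sup'_le _ _ fun k _ => hub n _
  have hcau : CauchySeq u := by
    refine cauchySeq_of_le_tendsto_0 (fun N : ℕ => (1 / ((N : ℝ) + 1)) * ‖e‖) ?_ ?_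
    · intro n m N hn hm
      have key : ∀ n m, N ≤ m → u n - u m ≤ (1 / ((N : ℝ) + 1)) • e := by
        intro n m hm
        have h1 : (1 / ((m : ℝ) + 1)) ≤ 1 / ((N : ℝ) + 1) := by gcongr
        have h2 := (hle m n).trans (add_le_add_right (smul_le_smul_of_nonneg_right h1 he0) (u m))
        exact sub_le_iff_le_add'.2 h2
      have h0 : 0 ≤ (1 / ((N : ℝ) + 1)) := by positivity
      have habs : |u n - u m| ≤ |(1 / ((N : ℝ) + 1)) • e| := by
        refine le_trans ?_ (le_abs_self _)
        refine abs_le'.2 ⟨key n m hm, ?_⟩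
        rw [neg_sub]
        exact key m n hn
      rw [dist_eq_norm]
      refine (norm_le_norm_of_abs_le_abs habs).trans ?_
      rw [norm_smul, Real.norm_of_nonneg h0]
    · simpa using tendsto_one_div_add_atTop_nhds_zero_nat.mul_const ‖e‖
  obtain ⟨m, hm⟩ := cauchySeq_tendsto_of_complete hcau
  refine ⟨m, ?_, ?_⟩
  · rintro _ ⟨θ, rfl⟩
    have hlim : Tendsto (fun n : ℕ => u n + (1 / ((n : ℝ) + 1)) • e) atTop (𝓝 m) := by
      simpa using hm.add
        ((tendsto_one_div_add_atTop_nhds_zero_nat (𝕜 := ℝ)).smul_const e)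
    exact ge_of_tendsto' hlim fun n => hub n θ
  · intro c hc
    exact le_of_tendsto' hm fun n => Finset.sup'_le _ _ fun k _ => hc ⟨_, rfl⟩

/-- The modulus `|a + i b| = ⋁_θ (cos θ) a + (sin θ) b`, an element of `X`. -/
noncomputable def modulus (z : Complexification X) : X := (exists_isLUB_rot z).choose

theorem isLUB_modulus (z : Complexification X) : IsLUB (Set.range (rot z)) (modulus z) :=
  (exists_isLUB_rot z).choose_spec

theorem rot_le_modulus (z : Complexification X) (θ : ℝ) : rot z θ ≤ modulus z :=
  (isLUB_modulus z).1 ⟨θ, rfl⟩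

theorem modulus_le {z : Complexification X} {c : X} (h : ∀ θ, rot z θ ≤ c) : modulus z ≤ c :=
  (isLUB_modulus z).2 (by rintro _ ⟨θ, rfl⟩; exact h θ)

theorem abs_re_le_modulus (z : Complexification X) : |z.re| ≤ modulus z :=
  abs_le'.2 ⟨by simpa [rot] using rot_le_modulus z 0,
    by simpa [rot] using rot_le_modulus z Real.pi⟩

theorem abs_im_le_modulus (z : Complexification X) : |z.im| ≤ modulus z :=
  abs_le'.2 ⟨by simpa [rot] using rot_le_modulus z (Real.pi / 2),
    by simpa [rot] using rot_le_modulus z (-(Real.pi / 2))⟩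

theorem modulus_nonneg (z : Complexification X) : 0 ≤ modulus z :=
  (abs_nonneg _).trans (abs_re_le_modulus z)

theorem modulus_add_le (z w : Complexification X) : modulus (z + w) ≤ modulus z + modulus w :=
  modulus_le fun θ => by
    have e : rot (z + w) θ = rot z θ + rot w θ := by simp only [rot, add_re, add_im]; module
    rw [e]
    exact add_le_add (rot_le_modulus z θ) (rot_le_modulus w θ)

theorem modulus_smul_le (c : ℂ) (z : Complexification X) : modulus (c • z) ≤ ‖c‖ • modulus z :=
  modulus_le fun θ => by
    have h1 : c.re = ‖c‖ * Real.cos c.arg := (Complex.norm_mul_cos_arg c).symm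
    have h2 : c.im = ‖c‖ * Real.sin c.arg := (Complex.norm_mul_sin_arg c).symm
    have e : rot (c • z) θ = ‖c‖ • rot z (θ - c.arg) := by
      simp only [rot, smul_re, smul_im, Real.cos_sub, Real.sin_sub]
      rw [h1, h2]
      module
    rw [e]
    exact smul_le_smul_of_nonneg_left (rot_le_modulus z _) (norm_nonneg c)

theorem modulus_smul (c : ℂ) (z : Complexification X) : modulus (c • z) = ‖c‖ • modulus z := by
  refine (modulus_smul_le c z).antisymm ?_
  rcases eq_or_ne c 0 with rfl | hc
  · simpa using modulus_nonneg (0 : Complexification X)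
  · have h := modulus_smul_le c⁻¹ (c • z)
    rw [inv_smul_smul₀ hc, norm_inv] at h
    have h' := smul_le_smul_of_nonneg_left h (norm_nonneg c)
    rwa [smul_inv_smul₀ (norm_ne_zero_iff.2 hc)] at h'

theorem modulus_zero : modulus (0 : Complexification X) = 0 := by
  simpa using modulus_smul 0 (0 : Complexification X)

theorem modulus_ofReal (x : X) : modulus (ofReal x) = |x| := by
  refine le_antisymm (modulus_le fun θ => ?_) (abs_re_le_modulus (ofReal x))
  have h : rot (ofReal x) θ ≤ |Real.cos θ| • |x| := by
    simpa [rot, ofReal] using smul_le_abs_smul (Real.cos θ) x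
  exact h.trans (by
    simpa using smul_le_smul_of_nonneg_right (Real.abs_cos_le_one θ) (abs_nonneg x))

/-- The norm `‖z‖ = ‖ |z| ‖`. -/
noncomputable instance : Norm (Complexification X) := ⟨fun z => ‖modulus z‖⟩

theorem norm_def (z : Complexification X) : ‖z‖ = ‖modulus z‖ := rfl

theorem normCore : NormedSpace.Core ℂ (Complexification X) where
  norm_nonneg z := norm_nonneg (modulus z)
  norm_smul c z := by simp [norm_def, modulus_smul, norm_smul]
  norm_triangle z w := by
    refine le_trans (norm_le_norm_of_abs_le_abs ?_) (norm_add_le (modulus z) (modulus w))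
    rw [abs_of_nonneg (modulus_nonneg _),
      abs_of_nonneg (add_nonneg (modulus_nonneg z) (modulus_nonneg w))]
    exact modulus_add_le z w
  norm_eq_zero_iff z := by
    refine ⟨fun h => ?_, fun h => by rw [h, norm_def, modulus_zero, norm_zero]⟩
    have h0 : modulus z = 0 := norm_eq_zero.1 h
    have h1 : ‖z.re‖ ≤ ‖modulus z‖ := norm_le_norm_of_abs_le_abs
      ((abs_re_le_modulus z).trans (le_abs_self _))
    have h2 : ‖z.im‖ ≤ ‖modulus z‖ := norm_le_norm_of_abs_le_abs
      ((abs_im_le_modulus z).trans (le_abs_self _))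
    rw [h0, norm_zero] at h1 h2
    ext
    · exact norm_le_zero_iff.1 h1
    · exact norm_le_zero_iff.1 h2

noncomputable instance : NormedAddCommGroup (Complexification X) :=
  NormedAddCommGroup.ofCore normCore

noncomputable instance : NormedSpace ℂ (Complexification X) :=
  NormedSpace.ofCore normCore

/-- The ideal `{z : ∃ n, |z| ≤ n |y|}` generated by `y`. -/
def ideal₀ (y : Complexification X) : Submodule ℂ (Complexification X) where
  carrier := {z | ∃ n : ℕ, modulus z ≤ n • modulus y}
  zero_mem' := ⟨0, by simp [modulus_zero]⟩
  add_mem' := by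
    rintro z w ⟨n, hn⟩ ⟨m, hm⟩
    exact ⟨n + m, by rw [add_nsmul]; exact (modulus_add_le z w).trans (add_le_add hn hm)⟩
  smul_mem' := by
    rintro c z ⟨n, hn⟩
    refine ⟨⌈‖c‖⌉₊ * n, ?_⟩
    rw [modulus_smul, mul_nsmul', ← Nat.cast_smul_eq_nsmul ℝ]
    exact (smul_le_smul_of_nonneg_left hn (norm_nonneg c)).trans
      (smul_le_smul_of_nonneg_right (Nat.le_ceil _) (nsmul_nonneg (modulus_nonneg y) n))

/-- The closed ideal generated by `y`. -/
noncomputable def closedIdeal (y : Complexification X) : Submodule ℂ (Complexification X) :=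
  (ideal₀ y).topologicalClosure

theorem ofReal_mem_closedIdeal {y : Complexification X} {x : X} (h : |x| ≤ modulus y) :
    ofReal x ∈ closedIdeal y :=
  (ideal₀ y).le_topologicalClosure ⟨1, by rw [modulus_ofReal, one_nsmul]; exact h⟩

/-- The modulus of `y` as an element of the closed ideal generated by `y`. -/
noncomputable def modulusIn (y : Complexification X) : closedIdeal y :=
  ⟨ofReal (modulus y), ofReal_mem_closedIdeal (abs_of_nonneg (modulus_nonneg y)).le⟩

/-- `|x| ∧ |y|` as an element of the closed ideal generated by `y`. -/
noncomputable def infIn (x y : Complexification X) : closedIdeal y :=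
  ⟨ofReal (modulus x ⊓ modulus y), ofReal_mem_closedIdeal
    ((abs_of_nonneg (le_inf (modulus_nonneg x) (modulus_nonneg y))).le.trans inf_le_right)⟩

/-- `S` is a modulus preserving complex linear operator on the closed ideal generated by `y`
which sends `|y|` to `y`. -/
def IsSign (y : Complexification X) (S : closedIdeal y →ₗ[ℂ] closedIdeal y) : Prop :=
  (∀ z : closedIdeal y, modulus (S z : Complexification X) = modulus (z : Complexification X)) ∧
    (S (modulusIn y) : Complexification X) = y

/-- The sign `S_y` of `y`: the operator satisfying `IsSign y` (in a Banach lattice there is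
exactly one). -/
noncomputable def sign (y : Complexification X) : closedIdeal y →ₗ[ℂ] closedIdeal y :=
  Classical.epsilon (IsSign y)

/-- `b(x,y) = S_y (|x| ∧ |y|)`. -/
noncomputable def lacey (x y : Complexification X) : Complexification X := sign y (infIn x y)

/-- A complex sign change is a modulus preserving complex linear map. -/
def IsSignChange (U : Complexification X →ₗ[ℂ] Complexification X) : Prop :=
  ∀ z, modulus (U z) = modulus z

/-- `F` is the complexification of a closed vector sublattice of `X`. -/
def IsClosedSublattice (F : Submodule ℂ (Complexification X)) : Prop :=
  ∃ Y : Submodule ℝ X, IsClosed (Y : Set X) ∧ IsVectorSublattice Y ∧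
    ∀ z : Complexification X, z ∈ F ↔ z.re ∈ Y ∧ z.im ∈ Y

/-- Some complex sign change maps `E` onto a closed complex sublattice. -/
def IsClosedSublatticeUpToSignChange (E : Submodule ℂ (Complexification X)) : Prop :=
  ∃ U : Complexification X →ₗ[ℂ] Complexification X, IsSignChange U ∧
    IsClosedSublattice (E.map U)

end Modulus

end Complexification

end BLat

/-!
Let `F` be a closed subspace that is invariant under `b`, and suppose that every nonzero element of
`F` meets some positive element of `F`. For `z ∈ F` and positive `d ∈ F` one has
`b(z, d) = |z| ∧ d`, so by order continuity there is a largest positive `d ∈ F` below `|z|`. The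
element `z - b(d, z)` of `F` has modulus `|z| - d` and is disjoint from all positive elements of
`F`, so `|z| = d ∈ F`; therefore `F` is a sublattice. In the complex case the real parts of the
elements of `F` are recovered from moduli, as `Re z = lim (|n |z| + z| - n |z|)`.

To reach this situation from `E`, choose by Zorn's lemma a maximal disjoint family in `E` and a sign
change that maps each of its elements to its modulus. Sign changes commute with `b`, because
`v = b(x, y)` is characterised by `|v| = |x| ∧ |y|` and `|y - v| = |y| - |x| ∧ |y|`.

A complex sign change of this kind is built by successive halving of angles. If the elements of a
disjoint family have their arguments in `[-β, β]`, then turning by `-β / 2` on the band where their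
imaginary parts are positive and by `β / 2` on the complementary band brings the arguments into
`[-β / 2, β / 2]`. Starting from `β = π`, the composed rotations converge in norm.
-/

namespace BLat

/-! ### The operation `b` of a real Banach lattice -/

theorem inf_eq_zero_of_le {X : Type*} [Lattice X] [Zero X] {a b p q : X} (ha : 0 ≤ a) (hb : 0 ≤ b)
    (hap : a ≤ p) (hbq : b ≤ q) (h : p ⊓ q = 0) : a ⊓ b = 0 :=
  le_antisymm ((inf_le_inf hap hbq).trans h.le) (le_inf ha hb)

section LatticeGroup

variable {X : Type*} [AddCommGroup X] [Lattice X] [IsOrderedAddMonoid X] {a b p q r x y : X}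

theorem eq_zero_of_abs_eq_zero (h : |x| = 0) : x = 0 :=
  le_antisymm (h ▸ le_abs_self x) (neg_nonpos.1 (h ▸ neg_le_abs x))

theorem inf_abs_eq_zero_of_abs_le_abs (hxy : |x| ≤ |y|) (h : |y| ⊓ |a| = 0) : |x| ⊓ |a| = 0 :=
  inf_eq_zero_of_le (abs_nonneg x) (abs_nonneg a) hxy le_rfl h

theorem add_inf_eq_zero (hp : 0 ≤ p) (hq : 0 ≤ q) (hpa : p ⊓ a = 0) (hqa : q ⊓ a = 0) :
    (p + q) ⊓ a = 0 := by
  have ha : 0 ≤ a := hpa ▸ inf_le_right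
  have hle : (p + q) ⊓ a ≤ q := calc
    (p + q) ⊓ a ≤ (p + q) ⊓ (a + q) := inf_le_inf_left _ (le_add_of_nonneg_right hq)
    _ = q := by rw [← inf_add, hpa, zero_add]
  exact le_antisymm ((le_inf hle inf_le_right).trans hqa.le) (le_inf (add_nonneg hp hq) ha)

theorem inf_add_of_inf_eq_zero (hr : 0 ≤ r) (h : p ⊓ q = 0) :
    r ⊓ (p + q) = r ⊓ p + r ⊓ q := by
  let _ : DistribLattice X := AddCommGroup.toDistribLattice X
  have hp : 0 ≤ p := h ▸ inf_le_left
  have hq : 0 ≤ q := h ▸ inf_le_right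
  have hpq : r ⊓ p ⊓ (r ⊓ q) = 0 :=
    inf_eq_zero_of_le (le_inf hr hp) (le_inf hr hq) inf_le_right inf_le_right h
  rw [← inf_add_sup p q, ← inf_add_sup (r ⊓ p), h, hpq, zero_add, zero_add, inf_sup_left]

theorem abs_sub_of_inf_eq_zero (h : |a| ⊓ |b| = 0) : |a - b| = |a| + |b| := by
  refine le_antisymm (by simpa only [sub_eq_add_neg, abs_neg] using abs_add_le a (-b)) ?_
  calc |a| + |b| = |a| ⊔ |b| - |a| ⊓ |b| := by rw [← inf_add_sup, h, zero_add, sub_zero]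
    _ = |(|b| - |a|)| := sup_sub_inf_eq_abs_sub _ _
    _ ≤ |a - b| := by rw [abs_sub_comm a b]; exact abs_abs_sub_abs_le b a

theorem abs_add_of_inf_eq_zero (h : |a| ⊓ |b| = 0) : |a + b| = |a| + |b| := by
  simpa only [sub_neg_eq_add, abs_neg] using abs_sub_of_inf_eq_zero (b := -b) (by rwa [abs_neg])

end LatticeGroup

section LaceyReal

variable {X : Type*} [NormedAddCommGroup X] [Lattice X] [IsOrderedAddMonoid X]

theorem abs_inf_posPart_add_abs_inf_negPart (x y : X) :
    |x| ⊓ y⁺ + |x| ⊓ y⁻ = |x| ⊓ |y| := by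
  rw [← posPart_add_negPart y,
    inf_add_of_inf_eq_zero (abs_nonneg x) (posPart_inf_negPart_eq_zero y)]

theorem abs_laceyReal (x y : X) : |laceyReal x y| = |x| ⊓ |y| := by
  have hp : 0 ≤ |x| ⊓ y⁺ := le_inf (abs_nonneg x) (posPart_nonneg y)
  have hn : 0 ≤ |x| ⊓ y⁻ := le_inf (abs_nonneg x) (negPart_nonneg y)
  have hpn : |x| ⊓ y⁺ ⊓ (|x| ⊓ y⁻) = 0 :=
    inf_eq_zero_of_le hp hn inf_le_right inf_le_right (posPart_inf_negPart_eq_zero y)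
  rw [laceyReal, abs_sub_of_inf_eq_zero (by rwa [abs_of_nonneg hp, abs_of_nonneg hn]),
    abs_of_nonneg hp, abs_of_nonneg hn, abs_inf_posPart_add_abs_inf_negPart]

theorem abs_sub_laceyReal (x y : X) : |y - laceyReal x y| = |y| - |x| ⊓ |y| := by
  have hp : 0 ≤ y⁺ - |x| ⊓ y⁺ := sub_nonneg.2 inf_le_right
  have hn : 0 ≤ y⁻ - |x| ⊓ y⁻ := sub_nonneg.2 inf_le_right
  have hpn : (y⁺ - |x| ⊓ y⁺) ⊓ (y⁻ - |x| ⊓ y⁻) = 0 :=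
    inf_eq_zero_of_le hp hn (sub_le_self _ (le_inf (abs_nonneg x) (posPart_nonneg y)))
      (sub_le_self _ (le_inf (abs_nonneg x) (negPart_nonneg y))) (posPart_inf_negPart_eq_zero y)
  calc |y - laceyReal x y| = |(y⁺ - |x| ⊓ y⁺) - (y⁻ - |x| ⊓ y⁻)| := by
        rw [laceyReal]; nth_rw 1 [← posPart_sub_negPart y]; congr 1; abel
    _ = (y⁺ - |x| ⊓ y⁺) + (y⁻ - |x| ⊓ y⁻) := by
        rw [abs_sub_of_inf_eq_zero (by rwa [abs_of_nonneg hp, abs_of_nonneg hn]),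
          abs_of_nonneg hp, abs_of_nonneg hn]
    _ = y⁺ + y⁻ - (|x| ⊓ y⁺ + |x| ⊓ y⁻) := by abel
    _ = |y| - |x| ⊓ |y| := by
        rw [posPart_add_negPart, abs_inf_posPart_add_abs_inf_negPart]

theorem laceyReal_of_nonneg {y : X} (hy : 0 ≤ y) (x : X) : laceyReal x y = |x| ⊓ y := by
  rw [laceyReal, posPart_of_nonneg hy, negPart_of_nonneg hy, inf_eq_right.2 (abs_nonneg x),
    sub_zero]

variable [NormedSpace ℝ X] {u v x y : X}

theorem posPart_add_of_abs_add_eq (h : |u + v| = |u| + |v|) : (u + v)⁺ = u⁺ + v⁺ := by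
  have h2 : 2 • (u + v)⁺ = 2 • (u⁺ + v⁺) := by
    rw [nsmul_add, ← abs_add_eq_two_nsmul_posPart, ← abs_add_eq_two_nsmul_posPart,
      ← abs_add_eq_two_nsmul_posPart, h]
    abel
  have h2' : (2 : ℝ) • (u + v)⁺ = (2 : ℝ) • (u⁺ + v⁺) := by simpa only [two_smul] using h2
  exact smul_right_injective X (two_ne_zero (α := ℝ)) h2'

theorem posPart_le_of_abs_eq_inf (hv : |v| = |x| ⊓ |y|) (hyv : |y - v| = |y| - |x| ⊓ |y|) :
    v⁺ ≤ |x| ⊓ y⁺ := by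
  have hsum : |v + (y - v)| = |v| + |y - v| := by rw [add_sub_cancel, hv, hyv, add_sub_cancel]
  have hpos : y⁺ = v⁺ + (y - v)⁺ := by
    rw [← posPart_add_of_abs_add_eq hsum, add_sub_cancel]
  have hvx : v⁺ ≤ |x| := calc
    v⁺ ≤ v⁺ + v⁻ := le_add_of_nonneg_right (negPart_nonneg v)
    _ = |x| ⊓ |y| := by rw [posPart_add_negPart, hv]
    _ ≤ |x| := inf_le_left
  refine le_inf hvx ?_
  rw [hpos]
  exact le_add_of_nonneg_right (posPart_nonneg _)

theorem eq_laceyReal (hv : |v| = |x| ⊓ |y|) (hyv : |y - v| = |y| - |x| ⊓ |y|) :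
    v = laceyReal x y := by
  have hp : v⁺ ≤ |x| ⊓ y⁺ := posPart_le_of_abs_eq_inf hv hyv
  have hn : v⁻ ≤ |x| ⊓ y⁻ := by
    rw [← posPart_neg, ← posPart_neg]
    refine posPart_le_of_abs_eq_inf (by rwa [abs_neg, abs_neg]) ?_
    rwa [neg_sub_neg, abs_sub_comm, abs_neg]
  have hsum : v⁺ + v⁻ = |x| ⊓ y⁺ + |x| ⊓ y⁻ := by
    rw [posPart_add_negPart, hv, abs_inf_posPart_add_abs_inf_negPart]
  obtain ⟨hp', hn'⟩ := (add_eq_add_iff_eq_and_eq hp hn).1 hsum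
  rw [laceyReal, ← hp', ← hn', posPart_sub_negPart]

theorem map_laceyReal {U : X →ₗ[ℝ] X} (hU : ∀ x, |U x| = |x|) (x y : X) :
    U (laceyReal x y) = laceyReal (U x) (U y) :=
  eq_laceyReal (by rw [hU, hU, hU, abs_laceyReal])
    (by rw [← map_sub, hU, hU, hU, abs_sub_laceyReal])

end LaceyReal

/-! ### Order continuity -/

section OrderContinuity

theorem exists_forall_norm_le_two_mul {X : Type*} [NormedAddCommGroup X] {s : Set X}
    (hs : s.Nonempty) {C : ℝ} (hC : ∀ x ∈ s, ‖x‖ ≤ C) : ∃ x ∈ s, ∀ y ∈ s, ‖y‖ ≤ 2 * ‖x‖ := by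
  by_cases h : ∀ y ∈ s, ‖y‖ ≤ 0
  · obtain ⟨x, hx⟩ := hs
    exact ⟨x, hx, fun y hy => (h y hy).trans (by positivity)⟩
  · push Not at h
    obtain ⟨y₀, hy₀, hpos⟩ := h
    have hbdd : BddAbove (norm '' s) := ⟨C, Set.forall_mem_image.2 hC⟩
    have hle : ∀ y ∈ s, ‖y‖ ≤ sSup (norm '' s) := fun y hy =>
      le_csSup hbdd (Set.mem_image_of_mem _ hy)
    obtain ⟨_, ⟨x, hx, rfl⟩, hlt⟩ := exists_lt_of_lt_csSup (hs.image norm)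
      (half_lt_self (hpos.trans_le (hle y₀ hy₀)))
    exact ⟨x, hx, fun y hy => by linarith [hle y hy]⟩

theorem IsOrderContinuous.tendsto_of_monotone {X : Type*} [NormedAddCommGroup X] [Lattice X]
    [IsOrderedAddMonoid X] (hX : IsOrderContinuous X) {u : ℕ → X} (hu : Monotone u)
    {r : X} (hr : ∀ n, u n ≤ r) : ∃ l, Tendsto u atTop (𝓝 l) := by
  obtain ⟨l, hl⟩ := hX (fun n => r - u n) (fun _ _ hmn => sub_le_sub_left (hu hmn) r)
    fun n => sub_nonneg.2 (hr n)
  exact ⟨r - l, by simpa only [sub_sub_cancel] using hl.const_sub r⟩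

variable {X : Type*} [NormedAddCommGroup X] [Lattice X] [IsOrderedAddMonoid X] [HasSolidNorm X]

theorem exists_ge_forall_norm_sub_le {D : Set X} {r a : X} (hr : r ∈ upperBounds D)
    (ha : a ∈ D) : ∃ b ∈ D, a ≤ b ∧ ∀ d ∈ D, a ≤ d → ‖d - a‖ ≤ 2 * ‖b - a‖ := by
  have hne : ((· - a) '' {d ∈ D | a ≤ d}).Nonempty := ⟨a - a, a, ⟨ha, le_rfl⟩, rfl⟩
  have hbound : ∀ x ∈ (· - a) '' {d ∈ D | a ≤ d}, ‖x‖ ≤ ‖r - a‖ := by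
    rintro _ ⟨d, ⟨hd, had⟩, rfl⟩
    refine norm_le_norm_of_abs_le_abs ?_
    rw [abs_of_nonneg (sub_nonneg.2 had), abs_of_nonneg (sub_nonneg.2 (hr ha))]
    exact sub_le_sub_right (hr hd) _
  obtain ⟨_, ⟨b, ⟨hb, hab⟩, rfl⟩, hmax⟩ := exists_forall_norm_le_two_mul hne hbound
  exact ⟨b, hb, hab, fun d hd had => hmax _ ⟨d, ⟨hd, had⟩, rfl⟩⟩

/-- The greatest element is the limit of a greedy increasing sequence, each of whose steps is at
least half as long as any other admissible step. -/
theorem IsOrderContinuous.exists_isGreatest (hX : IsOrderContinuous X) {D : Set X}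
    (hD : IsClosed D) (hsup : SupClosed D) (hne : D.Nonempty) (hbdd : BddAbove D) :
    ∃ l, IsGreatest D l := by
  obtain ⟨r, hr⟩ := hbdd
  have hstep : ∀ a : D, ∃ b : D, a ≤ b ∧
      ∀ d ∈ D, (a : X) ≤ d → ‖d - (a : X)‖ ≤ 2 * ‖(b : X) - a‖ := fun a => by
    obtain ⟨b, hb, hab, hmax⟩ := exists_ge_forall_norm_sub_le hr a.2
    exact ⟨⟨b, hb⟩, hab, hmax⟩
  choose next hle hgreedy using hstep
  obtain ⟨a₀, ha₀⟩ := hne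
  let a : ℕ → D := fun n => next^[n] ⟨a₀, ha₀⟩
  have ha : ∀ n, a (n + 1) = next (a n) := fun n => Function.iterate_succ_apply' next n _
  have hmono : Monotone fun n => (a n : X) :=
    monotone_nat_of_le_succ fun n => by rw [ha]; exact hle (a n)
  obtain ⟨l, hl⟩ := hX.tendsto_of_monotone hmono fun n => hr (a n).2
  refine ⟨l, hD.mem_of_tendsto hl (Eventually.of_forall fun n => (a n).2), fun d hd => ?_⟩
  have hsteps : Tendsto (fun n => 2 * ‖(a (n + 1) : X) - a n‖) atTop (𝓝 0) := by
    simpa using (((tendsto_add_atTop_iff_nat 1).2 hl).sub hl).norm.const_mul 2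
  have hexcess : Tendsto (fun n => (a n : X) ⊔ d - a n) atTop (𝓝 0) :=
    squeeze_zero_norm (fun n => by
      rw [ha]; exact hgreedy (a n) _ (hsup (a n).2 hd) le_sup_left) hsteps
  have hlim : l ⊔ d - l = 0 :=
    tendsto_nhds_unique ((hl.sup_nhds tendsto_const_nhds).sub hl) hexcess
  exact sup_eq_left.1 (sub_eq_zero.1 hlim)

end OrderContinuity

/-! ### Band projections -/

theorem smul_abs_le {X : Type*} [AddCommGroup X] [Module ℝ X] [Lattice X] [IsOrderedModule ℝ X]
    {t : ℝ} (ht : 0 ≤ t) {x y : X} (hxy : t • x ≤ y) (hxy' : t • -x ≤ y) : t • |x| ≤ y := by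
  rcases ht.eq_or_lt with rfl | ht
  · simpa only [zero_smul] using hxy
  · rw [← le_inv_smul_iff_of_pos ht] at hxy hxy' ⊢
    exact abs_le'.2 ⟨hxy, hxy'⟩

section Bands

variable {X : Type*} [NormedAddCommGroup X] [NormedSpace ℝ X] [Lattice X]

variable {P : X →ₗ[ℝ] X}

theorem IsBandProjection.inf_eq_zero (hP : IsBandProjection P) (x y : X) :
    |P x| ⊓ |y - P y| = 0 := by
  obtain ⟨B, -, hB⟩ := hP
  rw [inf_comm]
  exact (hB y).2 _ (hB x).1

variable [IsOrderedAddMonoid X]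

theorem IsBandProjection.apply_apply (hP : IsBandProjection P) (x : X) : P (P x) = P x := by
  have h := hP.inf_eq_zero (x - P x) (P x)
  rw [map_sub, inf_idem] at h
  exact (sub_eq_zero.1 (eq_zero_of_abs_eq_zero h)).symm

theorem IsBandProjection.abs_add_abs_sub (hP : IsBandProjection P) (x : X) :
    |P x| + |x - P x| = |x| := by
  rw [← abs_add_of_inf_eq_zero (hP.inf_eq_zero x x), add_sub_cancel]

theorem IsBandProjection.nonneg_and_le (hP : IsBandProjection P) {x : X} (hx : 0 ≤ x) :
    0 ≤ P x ∧ P x ≤ x := by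
  have hsum : P x + (x - P x) = |P x| + |x - P x| := by
    rw [hP.abs_add_abs_sub, abs_of_nonneg hx, add_sub_cancel]
  obtain ⟨h₁, h₂⟩ :=
    (add_eq_add_iff_eq_and_eq (le_abs_self (P x)) (le_abs_self (x - P x))).1 hsum
  exact ⟨h₁ ▸ abs_nonneg _, sub_nonneg.1 (h₂ ▸ abs_nonneg _)⟩

theorem IsBandProjection.monotone (hP : IsBandProjection P) : Monotone P := fun x y hxy => by
  simpa using (hP.nonneg_and_le (sub_nonneg.2 hxy)).1

theorem IsBandProjection.abs_two_smul_sub (hP : IsBandProjection P) (x : X) :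
    |((2 : ℝ) • P - LinearMap.id : X →ₗ[ℝ] X) x| = |x| := by
  have hsub : ((2 : ℝ) • P - LinearMap.id : X →ₗ[ℝ] X) x = P x - (x - P x) := by
    simp only [LinearMap.sub_apply, LinearMap.smul_apply, LinearMap.id_apply]
    module
  rw [hsub, abs_sub_of_inf_eq_zero (hP.inf_eq_zero x x), hP.abs_add_abs_sub]

theorem IsBandProjection.isSignChange [HasSolidNorm X] (hP : IsBandProjection P) :
    IsSignChange ((2 : ℝ) • P - LinearMap.id) := by
  refine ⟨AddMonoidHomClass.isometry_of_norm _ fun x => ?_, P, hP, rfl⟩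
  rw [← norm_abs_eq_norm, hP.abs_two_smul_sub, norm_abs_eq_norm]

variable {U : X →ₗ[ℝ] X}

theorem IsSignChange.abs_apply (hU : IsSignChange U) (x : X) : |U x| = |x| := by
  obtain ⟨-, P, hP, rfl⟩ := hU
  exact hP.abs_two_smul_sub x

theorem IsSignChange.apply_apply (hU : IsSignChange U) (x : X) : U (U x) = x := by
  obtain ⟨-, P, hP, rfl⟩ := hU
  simp only [LinearMap.sub_apply, LinearMap.smul_apply, LinearMap.id_apply, map_sub, map_smul,
    hP.apply_apply]
  module

variable [IsOrderedModule ℝ X]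

theorem abs_smul_le (t : ℝ) (x : X) : |t • x| ≤ |t| • |x| := by
  refine abs_le'.2 ⟨Complexification.smul_le_abs_smul t x, ?_⟩
  simpa only [smul_neg, abs_neg] using Complexification.smul_le_abs_smul t (-x)

theorem smul_inf_eq_zero {t : ℝ} (ht : 0 ≤ t) {p q : X} (h : p ⊓ q = 0) : (t • p) ⊓ q = 0 := by
  have hp : 0 ≤ p := h ▸ inf_le_left
  have hq : 0 ≤ q := h ▸ inf_le_right
  have hs : 0 < max t 1 := lt_max_of_lt_right one_pos
  have hle : (max t 1)⁻¹ • ((t • p) ⊓ q) ≤ p ⊓ q := le_inf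
    ((inv_smul_le_iff_of_pos hs).2 (inf_le_left.trans
      (smul_le_smul_of_nonneg_right (le_max_left t 1) hp)))
    ((inv_smul_le_iff_of_pos hs).2 (inf_le_right.trans
      (le_smul_of_one_le_left hq (le_max_right t 1))))
  rw [h, inv_smul_le_iff_of_pos hs, smul_zero] at hle
  exact le_antisymm hle (le_inf (smul_nonneg ht hp) hq)

/-- `A^⊥` as a linear subspace. -/
def bandCompl (A : Set X) : Submodule ℝ X where
  carrier := disjointCompl A
  zero_mem' a _ := by rw [abs_zero, inf_eq_left.2 (abs_nonneg a)]
  add_mem' {x y} hx hy a ha := inf_eq_zero_of_le (abs_nonneg _) (abs_nonneg a) (abs_add_le x y)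
    le_rfl (add_inf_eq_zero (abs_nonneg x) (abs_nonneg y) (hx a ha) (hy a ha))
  smul_mem' t x hx a ha := inf_eq_zero_of_le (abs_nonneg _) (abs_nonneg a) (abs_smul_le t x)
    le_rfl (smul_inf_eq_zero (abs_nonneg t) (hx a ha))

variable {A : Set X} {x y : X}

theorem mem_bandCompl : x ∈ bandCompl A ↔ ∀ a ∈ A, |x| ⊓ |a| = 0 := Iff.rfl

theorem mem_bandCompl_of_abs_le (hy : y ∈ bandCompl A) (hxy : |x| ≤ |y|) : x ∈ bandCompl A :=
  fun a ha => inf_abs_eq_zero_of_abs_le_abs hxy (hy a ha)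

theorem disjoint_bandCompl : Disjoint (bandCompl A) (bandCompl (bandCompl A : Set X)) :=
  Submodule.disjoint_def.2 fun x hx hx' => eq_zero_of_abs_eq_zero (by
    rw [← hx' x hx, inf_idem])

variable [HasSolidNorm X]

theorem isClosed_bandCompl (A : Set X) : IsClosed (bandCompl A : Set X) := by
  have hA : (bandCompl A : Set X) = ⋂ a ∈ A, {x | |x| ⊓ |a| = 0} := by
    ext x
    simp only [SetLike.mem_coe, mem_bandCompl, Set.mem_iInter, Set.mem_ofPred_eq]
  have habs : Continuous fun x : X => |x| := continuous_id.sup continuous_neg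
  rw [hA]
  exact isClosed_biInter fun a _ => isClosed_eq (habs.inf continuous_const) continuous_const

theorem exists_sub_mem_bandCompl (hX : IsOrderContinuous X) (A : Set X) (hx : 0 ≤ x) :
    ∃ l ∈ bandCompl A, x - l ∈ bandCompl (bandCompl A : Set X) := by
  have hclosed : IsClosed ((bandCompl A : Set X) ∩ Set.Icc 0 x) :=
    (isClosed_bandCompl A).inter isClosed_Icc
  have hsup : SupClosed ((bandCompl A : Set X) ∩ Set.Icc 0 x) := by
    rintro c ⟨hc, hc0, hcx⟩ d ⟨hd, hd0, hdx⟩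
    refine ⟨mem_bandCompl_of_abs_le (add_mem hc hd) ?_, hc0.trans le_sup_left, sup_le hcx hdx⟩
    rw [abs_of_nonneg (hc0.trans le_sup_left), abs_of_nonneg (add_nonneg hc0 hd0)]
    exact sup_le (le_add_of_nonneg_right hd0) (le_add_of_nonneg_left hc0)
  obtain ⟨l, ⟨hl, hl0, hlx⟩, hmax⟩ :=
    hX.exists_isGreatest hclosed hsup ⟨0, zero_mem _, le_rfl, hx⟩ ⟨x, fun c hc => hc.2.2⟩
  refine ⟨l, hl, fun b hb => ?_⟩
  rw [abs_of_nonneg (sub_nonneg.2 hlx)]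
  set w := (x - l) ⊓ |b|
  have hw0 : 0 ≤ w := le_inf (sub_nonneg.2 hlx) (abs_nonneg b)
  have hw : w ∈ bandCompl A :=
    mem_bandCompl_of_abs_le hb (by rw [abs_of_nonneg hw0]; exact inf_le_right)
  have hlw : l + w ≤ l := hmax ⟨add_mem hl hw, add_nonneg hl0 hw0,
    (add_le_add_right inf_le_left l).trans (add_sub_cancel l x).le⟩
  exact le_antisymm (by simpa using hlw) hw0

theorem isCompl_bandCompl (hX : IsOrderContinuous X) (A : Set X) :
    IsCompl (bandCompl A) (bandCompl (bandCompl A : Set X)) := by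
  refine ⟨disjoint_bandCompl, Submodule.codisjoint_iff_exists_add_eq.2 fun x => ?_⟩
  obtain ⟨p, hp, hp'⟩ := exists_sub_mem_bandCompl hX A (posPart_nonneg x)
  obtain ⟨n, hn, hn'⟩ := exists_sub_mem_bandCompl hX A (negPart_nonneg x)
  refine ⟨p - n, x⁺ - p - (x⁻ - n), sub_mem hp hn, sub_mem hp' hn', ?_⟩
  nth_rw 3 [← posPart_sub_negPart x]
  abel

/-- The projection onto the band `A^⊥` along `A^⊥⊥`. -/
noncomputable def bandProjection (hX : IsOrderContinuous X) (A : Set X) : X →ₗ[ℝ] X :=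
  (bandCompl A).projection _ (isCompl_bandCompl hX A)

theorem isBandProjection_bandProjection (hX : IsOrderContinuous X) (A : Set X) :
    IsBandProjection (bandProjection hX A) := by
  have h := isCompl_bandCompl hX A
  exact ⟨disjointCompl A, ⟨A, rfl⟩, fun x =>
    ⟨Submodule.projection_apply_mem h x, Submodule.sub_projection_mem h x⟩⟩

/-- One projects onto the band of all elements that are disjoint from the negative parts. -/
theorem exists_isBandProjection_apply_eq_posPart (hX : IsOrderContinuous X) {ι : Type*}
    {f : ι → X} (hf : Pairwise fun i j => |f i| ⊓ |f j| = 0) :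
    ∃ P : X →ₗ[ℝ] X, IsBandProjection P ∧ ∀ i, P (f i) = (f i)⁺ := by
  set A : Set X := Set.range fun i => (f i)⁻
  have hle : ∀ i, (f i)⁺ ≤ |f i| ∧ (f i)⁻ ≤ |f i| := fun i => by
    rw [← posPart_add_negPart]
    exact ⟨le_add_of_nonneg_right (negPart_nonneg _), le_add_of_nonneg_left (posPart_nonneg _)⟩
  have hpos : ∀ i, (f i)⁺ ∈ bandCompl A := by
    rintro i _ ⟨j, rfl⟩
    rw [abs_of_nonneg (posPart_nonneg _), abs_of_nonneg (negPart_nonneg _)]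
    rcases eq_or_ne i j with rfl | hij
    · exact posPart_inf_negPart_eq_zero _
    · exact inf_eq_zero_of_le (posPart_nonneg _) (negPart_nonneg _) (hle i).1 (hle j).2 (hf hij)
  have hneg : ∀ i, (f i)⁻ ∈ bandCompl (bandCompl A : Set X) := fun i x hx => by
    rw [inf_comm]
    exact hx _ ⟨i, rfl⟩
  refine ⟨bandProjection hX A, isBandProjection_bandProjection hX A, fun i => ?_⟩
  nth_rw 1 [← posPart_sub_negPart (f i)]
  rw [map_sub, bandProjection, Submodule.projection_apply_of_mem_left _ (hpos i),
    (Submodule.projection_apply_eq_zero_iff _).2 (hneg i), sub_zero]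

end Bands

theorem exists_maximal_disjoint {V X : Type*} [Lattice X] [Zero X] (m : V → X) (E : Set V) :
    ∃ S ⊆ E, S.Pairwise (fun e f => m e ⊓ m f = 0) ∧
      ∀ x ∈ E, (∀ e ∈ S, m x ⊓ m e = 0) → m x = 0 := by
  obtain ⟨S, hS⟩ := zorn_subset {S : Set V | S ⊆ E ∧ S.Pairwise (fun e f => m e ⊓ m f = 0)} (by
    refine fun c hc hchain => ⟨⋃₀ c, ⟨Set.sUnion_subset fun s hs => (hc hs).1, ?_⟩, fun s hs =>
      Set.subset_sUnion_of_mem hs⟩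
    exact (Set.pairwise_sUnion hchain.directedOn).2 fun s hs => (hc hs).2)
  refine ⟨S, hS.prop.1, hS.prop.2, fun x hx hd => ?_⟩
  have hins : insert x S ⊆ S := hS.le_of_ge ⟨Set.insert_subset hx hS.prop.1,
    hS.prop.2.insert fun e he _ => ⟨hd e he, by rw [inf_comm]; exact hd e he⟩⟩
    (Set.subset_insert x S)
  simpa using hd x (hins (Set.mem_insert x S))

section Sublattice

variable {X : Type*} [NormedAddCommGroup X] [NormedSpace ℝ X] [Lattice X] {Y : Submodule ℝ X}

theorem IsVectorSublattice.abs_mem (hY : IsVectorSublattice Y) {x : X} (hx : x ∈ Y) : |x| ∈ Y :=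
  (hY _ hx _ (neg_mem hx)).1

theorem IsVectorSublattice.laceyReal_mem (hY : IsVectorSublattice Y) {x y : X} (hx : x ∈ Y)
    (hy : y ∈ Y) : laceyReal x y ∈ Y := by
  have hpos : y⁺ ∈ Y := (hY _ hy _ Y.zero_mem).1
  have hneg : y⁻ ∈ Y := (hY _ (neg_mem hy) _ Y.zero_mem).1
  exact sub_mem (hY _ (hY.abs_mem hx) _ hpos).2 (hY _ (hY.abs_mem hx) _ hneg).2

/-- A vector sublattice is a lattice for the induced order. -/
abbrev IsVectorSublattice.lattice (hY : IsVectorSublattice Y) : Lattice Y :=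
  Subtype.lattice (fun x y hx hy => (hY x hx y hy).1) fun x y hx hy => (hY x hx y hy).2

theorem IsVectorSublattice.hasSolidNorm [HasSolidNorm X] (hY : IsVectorSublattice Y) :
    letI := hY.lattice
    HasSolidNorm Y :=
  letI := hY.lattice
  ⟨fun _ _ hxy => norm_le_norm_of_abs_le_abs (α := X) hxy⟩

theorem IsVectorSublattice.isOrderContinuous (hX : IsOrderContinuous X)
    (hYc : IsClosed (Y : Set X)) (hY : IsVectorSublattice Y) :
    letI := hY.lattice
    IsOrderContinuous Y := fun u hu hu0 => by
  obtain ⟨l, hl⟩ := hX (fun n => u n) hu hu0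
  exact ⟨⟨l, hYc.mem_of_tendsto hl (Eventually.of_forall fun n => (u n).2)⟩,
    tendsto_subtype_rng.2 hl⟩

variable [IsOrderedAddMonoid X]

theorem isVectorSublattice_of_abs_mem (habs : ∀ x ∈ Y, |x| ∈ Y) : IsVectorSublattice Y := by
  intro x hx y hy
  have hd : |y - x| ∈ Y := habs _ (sub_mem hy hx)
  have hsup : x ⊔ y = (2⁻¹ : ℝ) • (x + y + |y - x|) := by
    rw [← two_nsmul_sup_eq_add_add_abs_sub]
    module
  have hinf : x ⊓ y = (2⁻¹ : ℝ) • (x + y - |y - x|) := by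
    rw [← two_nsmul_inf_eq_add_sub_abs_sub]
    module
  rw [hsup, hinf]
  exact ⟨Y.smul_mem _ (add_mem (add_mem hx hy) hd), Y.smul_mem _ (sub_mem (add_mem hx hy) hd)⟩

/-- Here `M` plays the role of the set of moduli of the elements of a space invariant under
truncation, and `Y` that of its real part. -/
theorem subset_of_inf_mem [HasSolidNorm X] (hX : IsOrderContinuous X) (hYc : IsClosed (Y : Set X))
    {M : Set X} (hM : ∀ r ∈ M, 0 ≤ r) (hYM : ∀ d ∈ Y, 0 ≤ d → d ∈ M)
    (hinf : ∀ r ∈ M, ∀ d ∈ Y, 0 ≤ d → r ⊓ d ∈ Y)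
    (hsub : ∀ r ∈ M, ∀ d ∈ Y, 0 ≤ d → d ≤ r → r - d ∈ M)
    (hmax : ∀ r ∈ M, (∀ d ∈ Y, 0 ≤ d → r ⊓ d = 0) → r = 0) : M ⊆ Y := by
  intro r hr
  have hclosed : IsClosed ((Y : Set X) ∩ Set.Icc 0 r) := hYc.inter isClosed_Icc
  have hsup : SupClosed ((Y : Set X) ∩ Set.Icc 0 r) := by
    rintro c ⟨hc, hc0, hcr⟩ d ⟨hd, hd0, hdr⟩
    refine ⟨?_, hc0.trans le_sup_left, sup_le hcr hdr⟩
    rw [← add_sub_cancel_left (c ⊓ d) (c ⊔ d), inf_add_sup]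
    exact sub_mem (add_mem hc hd) (hinf c (hYM c hc hc0) d hd hd0)
  obtain ⟨l, ⟨hl, hl0, hlr⟩, hgreatest⟩ := hX.exists_isGreatest hclosed hsup
    ⟨0, Y.zero_mem, le_rfl, hM r hr⟩ ⟨r, fun c hc => hc.2.2⟩
  have hrl : r - l ∈ M := hsub r hr l hl hl0 hlr
  have hzero : r - l = 0 := hmax _ hrl fun d hd hd0 => by
    have hw0 : 0 ≤ (r - l) ⊓ d := le_inf (sub_nonneg.2 hlr) hd0
    have hlw : l + (r - l) ⊓ d ≤ l := hgreatest ⟨add_mem hl (hinf _ hrl d hd hd0),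
      add_nonneg hl0 hw0, (add_le_add_right inf_le_left l).trans (add_sub_cancel l r).le⟩
    exact le_antisymm (by simpa using hlw) hw0
  rw [sub_eq_zero.1 hzero]
  exact hl

end Sublattice

/-! ### The real case -/

section RealCase

variable {X : Type*} [NormedAddCommGroup X] [NormedSpace ℝ X] [Lattice X] [IsOrderedAddMonoid X]
  {E F : Submodule ℝ X} {U : X →ₗ[ℝ] X}

theorem IsSignChange.isClosed_map (hU : IsSignChange U) (hE : IsClosed (E : Set X)) :
    IsClosed (E.map U : Set X) := by
  have hmap : (E.map U : Set X) = U ⁻¹' E := by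
    rw [Submodule.map_coe]
    exact congrFun (Set.image_eq_preimage_of_inverse hU.apply_apply hU.apply_apply) _
  rw [hmap]
  exact hE.preimage hU.1.continuous

theorem map_laceyReal_mem (hU : IsSignChange U) (hE : ∀ x ∈ E, ∀ y ∈ E, laceyReal x y ∈ E) :
    ∀ x ∈ E.map U, ∀ y ∈ E.map U, laceyReal x y ∈ E.map U := by
  rintro _ ⟨x, hx, rfl⟩ _ ⟨y, hy, rfl⟩
  exact ⟨laceyReal x y, hE x hx y hy, map_laceyReal hU.abs_apply x y⟩

theorem laceyReal_mem_of_isClosedSublatticeUpToSignChange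
    (h : IsClosedSublatticeUpToSignChange E) {x y : X} (hx : x ∈ E) (hy : y ∈ E) :
    laceyReal x y ∈ E := by
  obtain ⟨U, hU, -, hUE⟩ := h
  have hmem := hUE.laceyReal_mem (Submodule.mem_map_of_mem hx) (Submodule.mem_map_of_mem hy)
  rw [← map_laceyReal hU.abs_apply] at hmem
  exact (Function.LeftInverse.injective hU.apply_apply).mem_set_image.1 hmem

variable [HasSolidNorm X]

/-- The moduli of the elements of `F` are suprema of positive elements of `F`. -/
theorem isVectorSublattice_of_laceyReal_mem (hX : IsOrderContinuous X)
    (hFc : IsClosed (F : Set X)) (hF : ∀ x ∈ F, ∀ y ∈ F, laceyReal x y ∈ F)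
    (hmax : ∀ x ∈ F, (∀ d ∈ F, 0 ≤ d → |x| ⊓ d = 0) → x = 0) : IsVectorSublattice F := by
  refine isVectorSublattice_of_abs_mem fun x hx =>
    subset_of_inf_mem (M := {r | ∃ x ∈ F, |x| = r}) hX hFc ?_ ?_ ?_ ?_ ?_ ⟨x, hx, rfl⟩
  · rintro _ ⟨x, -, rfl⟩
    exact abs_nonneg x
  · exact fun d hd hd0 => ⟨d, hd, abs_of_nonneg hd0⟩
  · rintro _ ⟨x, hx, rfl⟩ d hd hd0
    rw [← laceyReal_of_nonneg hd0]
    exact hF x hx d hd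
  · rintro _ ⟨x, hx, rfl⟩ d hd hd0 hdx
    refine ⟨x - laceyReal d x, sub_mem hx (hF d hd x hx), ?_⟩
    rw [abs_sub_laceyReal, abs_of_nonneg hd0, inf_eq_left.2 hdx]
  · rintro _ ⟨x, hx, rfl⟩ h
    rw [hmax x hx h, abs_zero]

variable [IsOrderedModule ℝ X]

theorem isClosedSublatticeUpToSignChange_of_laceyReal_mem (hX : IsOrderContinuous X)
    (hEc : IsClosed (E : Set X)) (hE : ∀ x ∈ E, ∀ y ∈ E, laceyReal x y ∈ E) :
    IsClosedSublatticeUpToSignChange E := by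
  obtain ⟨S, hSE, hdisj, hmax⟩ := exists_maximal_disjoint (fun x : X => |x|) (E : Set X)
  obtain ⟨P, hP, hPS⟩ := exists_isBandProjection_apply_eq_posPart hX
    (f := ((↑) : S → X)) fun e f hef => hdisj e.2 f.2 (Subtype.coe_ne_coe.2 hef)
  set U : X →ₗ[ℝ] X := (2 : ℝ) • P - LinearMap.id
  have hU : IsSignChange U := hP.isSignChange
  have hUS : ∀ e ∈ S, U e = |e| := fun e he => by
    calc U e = (2 : ℝ) • P e - e := rfl
      _ = 2 • e⁺ - e := by rw [hPS ⟨e, he⟩, ofNat_smul_eq_nsmul]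
      _ = |e| := by rw [← abs_add_eq_two_nsmul_posPart, add_sub_cancel_right]
  refine ⟨U, hU, hU.isClosed_map hEc, isVectorSublattice_of_laceyReal_mem hX (hU.isClosed_map hEc)
    (map_laceyReal_mem hU hE) ?_⟩
  rintro _ ⟨x, hx, rfl⟩ hx'
  rw [eq_zero_of_abs_eq_zero (hmax x hx fun e he => ?_), map_zero]
  rw [← hU.abs_apply]
  exact hx' |e| ⟨e, hSE he, hUS e he⟩ (abs_nonneg e)

theorem isClosedSublatticeUpToSignChange_iff (hX : IsOrderContinuous X)
    (hE : IsClosed (E : Set X)) :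
    IsClosedSublatticeUpToSignChange E ↔ ∀ x ∈ E, ∀ y ∈ E, laceyReal x y ∈ E :=
  ⟨fun h _ hx _ hy => laceyReal_mem_of_isClosedSublatticeUpToSignChange h hx hy,
    isClosedSublatticeUpToSignChange_of_laceyReal_mem hX hE⟩

end RealCase

theorem exists_linearIsometryEquiv_tendsto {𝕜 V : Type*} [NormedField 𝕜] [NormedAddCommGroup V]
    [NormedSpace 𝕜 V] [CompleteSpace V] {U : ℕ → V ≃ₗᵢ[𝕜] V} {C r : ℝ} (hr : r < 1)
    (hU : ∀ n x, ‖U n x - U (n + 1) x‖ ≤ C * ‖x‖ * r ^ n) :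
    ∃ T : V ≃ₗᵢ[𝕜] V, ∀ x, Tendsto (fun n => U n x) atTop (𝓝 (T x)) := by
  have hcauchy : ∀ x, CauchySeq fun n => U n x := fun x =>
    cauchySeq_of_le_geometric r (C * ‖x‖) hr fun n => by rw [dist_eq_norm]; exact hU n x
  have hcauchy_symm : ∀ x, CauchySeq fun n => (U n).symm x := fun x =>
    cauchySeq_of_le_geometric r (C * ‖x‖) hr fun n => by
      have h := hU n ((U (n + 1)).symm x)
      rw [LinearIsometryEquiv.norm_map] at h
      rw [dist_eq_norm, ← (U n).norm_map, map_sub, (U n).apply_symm_apply, norm_sub_rev]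
      simpa only [LinearIsometryEquiv.apply_symm_apply] using h
  choose T hT using fun x => cauchySeq_tendsto_of_complete (hcauchy x)
  choose T' hT' using fun x => cauchySeq_tendsto_of_complete (hcauchy_symm x)
  let L : V →ₗ[𝕜] V := linearMapOfTendsto T (fun n => (U n).toLinearEquiv.toLinearMap)
    (tendsto_pi_nhds.2 hT)
  have hnorm : ∀ x, ‖L x‖ = ‖x‖ := fun x =>
    tendsto_nhds_unique (hT x).norm (by
      simp only [LinearIsometryEquiv.norm_map, tendsto_const_nhds])
  have hsurj : Function.Surjective L := fun x => by
    refine ⟨T' x, tendsto_nhds_unique (hT (T' x)) (tendsto_iff_norm_sub_tendsto_zero.2 ?_)⟩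
    refine (tendsto_iff_norm_sub_tendsto_zero.1 (hT' x)).congr fun n => ?_
    rw [norm_sub_rev, ← (U n).norm_map, map_sub, (U n).apply_symm_apply]
  exact ⟨LinearIsometryEquiv.ofSurjective ⟨L, hnorm⟩ hsurj, hT⟩

namespace Complexification

/-! ### The complexification as a Banach space -/

section Map

variable {Z X : Type*}

/-- The map `a + ib ↦ j a + i j b` between complexifications. -/
def map (j : Z → X) (z : Complexification Z) : Complexification X := ⟨j z.re, j z.im⟩

@[simp] theorem map_re (j : Z → X) (z : Complexification Z) : (map j z).re = j z.re := rfl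

@[simp] theorem map_im (j : Z → X) (z : Complexification Z) : (map j z).im = j z.im := rfl

end Map

section Algebra

variable {X : Type*} [AddCommGroup X]

@[simp] theorem ofReal_re (x : X) : (ofReal x).re = x := rfl

@[simp] theorem ofReal_im (x : X) : (ofReal x).im = 0 := rfl

theorem ofReal_sub (x y : X) : ofReal (x - y) = ofReal x - ofReal y := by
  ext <;> simp

end Algebra

section Topology

variable {X : Type*} [NormedAddCommGroup X] [NormedSpace ℝ X] [Lattice X] [IsOrderedAddMonoid X]
  [IsOrderedModule ℝ X] [HasSolidNorm X] [CompleteSpace X]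

theorem modulus_sub_comm (z w : Complexification X) : modulus (z - w) = modulus (w - z) := by
  simpa using modulus_smul (-1) (w - z)

theorem abs_modulus_sub_le (z w : Complexification X) :
    |modulus z - modulus w| ≤ modulus (z - w) := by
  refine abs_le'.2 ⟨?_, ?_⟩
  · rw [sub_le_iff_le_add]
    simpa using modulus_add_le (z - w) w
  · rw [neg_sub, sub_le_iff_le_add, modulus_sub_comm]
    simpa using modulus_add_le (w - z) z

theorem modulus_le_abs_add_abs (z : Complexification X) : modulus z ≤ |z.re| + |z.im| := by
  have hz : z = ofReal z.re + Complex.I • ofReal z.im := by ext <;> simp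
  calc modulus z ≤ modulus (ofReal z.re) + modulus (Complex.I • ofReal z.im) := by
        nth_rw 1 [hz]; exact modulus_add_le _ _
    _ = |z.re| + |z.im| := by
        rw [modulus_smul, modulus_ofReal, modulus_ofReal, Complex.norm_I, one_smul]

theorem norm_le_of_abs_le_modulus {x : X} {z : Complexification X} (h : |x| ≤ modulus z) :
    ‖x‖ ≤ ‖z‖ :=
  norm_le_norm_of_abs_le_abs (h.trans (le_abs_self _))

theorem norm_le_of_modulus_le_smul {c : ℝ} (hc : 0 ≤ c) {z w : Complexification X}
    (h : modulus z ≤ c • modulus w) : ‖z‖ ≤ c * ‖w‖ := by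
  rw [norm_def, norm_def, ← norm_smul_of_nonneg hc]
  refine norm_le_norm_of_abs_le_abs ?_
  rwa [abs_of_nonneg (modulus_nonneg z), abs_of_nonneg (smul_nonneg hc (modulus_nonneg w))]

theorem norm_le_norm_re_add_norm_im (z : Complexification X) : ‖z‖ ≤ ‖z.re‖ + ‖z.im‖ := by
  rw [norm_def, ← norm_abs_eq_norm z.re, ← norm_abs_eq_norm z.im]
  refine (norm_le_norm_of_abs_le_abs ?_).trans (norm_add_le _ _)
  rw [abs_of_nonneg (modulus_nonneg z)]
  exact (modulus_le_abs_add_abs z).trans (le_abs_self _)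

theorem continuous_modulus : Continuous (modulus : Complexification X → X) :=
  (LipschitzWith.mk_one fun z w => by
    rw [dist_eq_norm, dist_eq_norm]
    exact norm_le_of_abs_le_modulus (abs_modulus_sub_le z w)).continuous

theorem lipschitzWith_re : LipschitzWith 1 (re : Complexification X → X) :=
  LipschitzWith.mk_one fun z w => by
    rw [dist_eq_norm, dist_eq_norm]
    exact norm_le_of_abs_le_modulus (abs_re_le_modulus (z - w))

theorem lipschitzWith_im : LipschitzWith 1 (im : Complexification X → X) :=
  LipschitzWith.mk_one fun z w => by
    rw [dist_eq_norm, dist_eq_norm]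
    exact norm_le_of_abs_le_modulus (abs_im_le_modulus (z - w))

theorem continuous_ofReal : Continuous (ofReal : X → Complexification X) :=
  (LipschitzWith.mk_one fun x y => by
    rw [dist_eq_norm, dist_eq_norm, ← ofReal_sub, norm_def, modulus_ofReal,
      norm_abs_eq_norm]).continuous

instance : CompleteSpace (Complexification X) := by
  refine Metric.complete_of_cauchySeq_tendsto fun z hz => ?_
  have hre : CauchySeq fun n => (z n).re := hz.map lipschitzWith_re.uniformContinuous
  have him : CauchySeq fun n => (z n).im := hz.map lipschitzWith_im.uniformContinuous
  obtain ⟨x, hx⟩ := cauchySeq_tendsto_of_complete hre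
  obtain ⟨y, hy⟩ := cauchySeq_tendsto_of_complete him
  refine ⟨⟨x, y⟩, tendsto_iff_norm_sub_tendsto_zero.2 ?_⟩
  refine squeeze_zero (fun n => norm_nonneg _) (fun n => norm_le_norm_re_add_norm_im _) ?_
  simpa using (tendsto_iff_norm_sub_tendsto_zero.1 hx).add (tendsto_iff_norm_sub_tendsto_zero.1 hy)

end Topology

section BandMul

variable {X : Type*} [NormedAddCommGroup X] [NormedSpace ℝ X]

/-- The operator that multiplies by `ω` on the range and by `η` on the kernel of a projection `P`
of `X`. -/
def bandMul (P : X →ₗ[ℝ] X) (ω η : ℂ) : Complexification X →ₗ[ℂ] Complexification X where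
  toFun z := ω • map P z + η • (z - map P z)
  map_add' z w := by ext <;> simp <;> module
  map_smul' c z := by ext <;> simp <;> module

variable {P : X →ₗ[ℝ] X}

theorem bandMul_apply (P : X →ₗ[ℝ] X) (ω η : ℂ) (z : Complexification X) :
    bandMul P ω η z = ω • map P z + η • (z - map P z) := rfl

theorem bandMul_one_one (P : X →ₗ[ℝ] X) : bandMul P 1 1 = LinearMap.id :=
  LinearMap.ext fun z => by simp [bandMul_apply]

theorem bandMul_sub_self (P : X →ₗ[ℝ] X) (ω η : ℂ) (z : Complexification X) :
    bandMul P ω η z - z = bandMul P (ω - 1) (η - 1) z := by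
  simp only [bandMul_apply]
  module

variable [Lattice X] [IsOrderedAddMonoid X]

theorem bandMul_bandMul (hP : IsBandProjection P) (ω η ω' η' : ℂ) (z : Complexification X) :
    bandMul P ω η (bandMul P ω' η' z) = bandMul P (ω * ω') (η * η') z := by
  ext <;> simp [bandMul_apply, hP.apply_apply] <;> module

variable [IsOrderedModule ℝ X] [HasSolidNorm X] [CompleteSpace X]

theorem modulus_bandMul_le (hP : IsBandProjection P) {ω η : ℂ} {s : ℝ} (hω : ‖ω‖ ≤ s)
    (hη : ‖η‖ ≤ s) (z : Complexification X) : modulus (bandMul P ω η z) ≤ s • modulus z := by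
  refine modulus_le fun θ => ?_
  have hrot : ∀ c : ℂ, ‖c‖ ≤ s → rot (c • z) θ ≤ s • modulus z := fun c hc => calc
    rot (c • z) θ ≤ modulus (c • z) := rot_le_modulus _ θ
    _ = ‖c‖ • modulus z := modulus_smul c z
    _ ≤ s • modulus z := smul_le_smul_of_nonneg_right hc (modulus_nonneg z)
  have hω' := hP.monotone (hrot ω hω)
  have hη' := (hP.nonneg_and_le (sub_nonneg.2 (hrot η hη))).2
  rw [map_sub, sub_le_sub_iff] at hη'
  have hsplit : rot (bandMul P ω η z) θ =
      P (rot (ω • z) θ) + (rot (η • z) θ - P (rot (η • z) θ)) := by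
    simp only [rot, bandMul_apply, add_re, add_im, sub_re, sub_im, smul_re, smul_im, map_re,
      map_im, map_add, map_sub, map_smul]
    module
  calc rot (bandMul P ω η z) θ
      = P (rot (ω • z) θ) + (rot (η • z) θ - P (rot (η • z) θ)) := hsplit
    _ ≤ P (s • modulus z) + (s • modulus z - P (s • modulus z)) := by
        refine add_le_add hω' ?_
        rwa [sub_le_sub_iff, add_comm (rot _ _)]
    _ = s • modulus z := add_sub_cancel _ _

theorem modulus_bandMul (hP : IsBandProjection P) {ω η : ℂ} (hω : ‖ω‖ = 1)
    (hη : ‖η‖ = 1) (z : Complexification X) : modulus (bandMul P ω η z) = modulus z := by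
  have hω0 : ω ≠ 0 := norm_ne_zero_iff.1 (hω ▸ one_ne_zero)
  have hη0 : η ≠ 0 := norm_ne_zero_iff.1 (hη ▸ one_ne_zero)
  refine le_antisymm (by simpa using modulus_bandMul_le hP hω.le hη.le z) ?_
  have h := modulus_bandMul_le hP (ω := ω⁻¹) (η := η⁻¹) (s := 1) (by simp [hω]) (by simp [hη])
    (bandMul P ω η z)
  rwa [bandMul_bandMul hP, inv_mul_cancel₀ hω0, inv_mul_cancel₀ hη0, bandMul_one_one,
    LinearMap.id_apply, one_smul] at h

/-- `bandMul P ω η` for a band projection `P` and unimodular `ω` and `η`. -/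
noncomputable def bandMulEquiv (hP : IsBandProjection P) {ω η : ℂ} (hω : ‖ω‖ = 1) (hη : ‖η‖ = 1) :
    Complexification X ≃ₗᵢ[ℂ] Complexification X :=
  LinearIsometryEquiv.ofSurjective
    ⟨bandMul P ω η, fun z => by rw [norm_def, norm_def, modulus_bandMul hP hω hη]⟩ fun z =>
      ⟨bandMul P ω⁻¹ η⁻¹ z, by
        have hω0 : ω ≠ 0 := norm_ne_zero_iff.1 (hω ▸ one_ne_zero)
        have hη0 : η ≠ 0 := norm_ne_zero_iff.1 (hη ▸ one_ne_zero)
        exact (bandMul_bandMul hP ω η ω⁻¹ η⁻¹ z).trans (by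
          rw [mul_inv_cancel₀ hω0, mul_inv_cancel₀ hη0, bandMul_one_one, LinearMap.id_apply])⟩

end BandMul

/-! ### Sign changes by halving of angles -/

section Sector

variable {X : Type*} [AddCommGroup X] [Module ℝ X] [Lattice X]
  [IsOrderedAddMonoid X]

/-- `z` lies in the sector `|arg z| ≤ β`, for `0 < β ≤ π`. For `β = 0` the condition only says that
`z.im = 0`. -/
def InSector (β : ℝ) (z : Complexification X) : Prop :=
  Real.cos β • |z.im| ≤ Real.sin β • z.re

theorem inSector_pi (z : Complexification X) : InSector Real.pi z := by
  rw [InSector, Real.cos_pi, Real.sin_pi, zero_smul, neg_one_smul]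
  exact neg_nonpos.2 (abs_nonneg _)

end Sector

section SignChange

variable {X : Type*} [NormedAddCommGroup X] [NormedSpace ℝ X] [Lattice X] [IsOrderedAddMonoid X]
  [IsOrderedModule ℝ X] [HasSolidNorm X] [CompleteSpace X]

/-- The sign change `bandMul P (exp (-iα)) (exp (iα))`: with `W = 2 P - 1`, it is multiplication by
`exp (-iα W)`. -/
noncomputable def bandRotation {P : X →ₗ[ℝ] X} (hP : IsBandProjection P) (α : ℝ) :
    Complexification X ≃ₗᵢ[ℂ] Complexification X :=
  bandMulEquiv hP (Complex.norm_exp_I_mul_ofReal (-α)) (Complex.norm_exp_I_mul_ofReal α)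

variable {P : X →ₗ[ℝ] X}

theorem bandRotation_apply (hP : IsBandProjection P) (α : ℝ) (z : Complexification X) :
    bandRotation hP α z =
      bandMul P (Complex.exp (Complex.I * (-α : ℝ))) (Complex.exp (Complex.I * α)) z := rfl

theorem modulus_bandRotation (hP : IsBandProjection P) (α : ℝ) (z : Complexification X) :
    modulus (bandRotation hP α z) = modulus z :=
  modulus_bandMul hP (Complex.norm_exp_I_mul_ofReal (-α)) (Complex.norm_exp_I_mul_ofReal α) z

theorem norm_bandRotation_sub_self_le (hP : IsBandProjection P) (α : ℝ) (z : Complexification X) :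
    ‖bandRotation hP α z - z‖ ≤ |α| * ‖z‖ := by
  rw [bandRotation_apply, bandMul_sub_self]
  refine norm_le_of_modulus_le_smul (abs_nonneg α) (modulus_bandMul_le hP ?_ ?_ z)
  · simpa using Real.norm_exp_I_mul_ofReal_sub_one_le (x := -α)
  · exact Real.norm_exp_I_mul_ofReal_sub_one_le

theorem bandRotation_re (hP : IsBandProjection P) (α : ℝ) (z : Complexification X) :
    (bandRotation hP α z).re =
      Real.cos α • z.re + Real.sin α • ((2 : ℝ) • P - LinearMap.id : X →ₗ[ℝ] X) z.im := by
  simp only [bandRotation_apply, mul_comm Complex.I, bandMul_apply, add_re, smul_re,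
    Complex.exp_ofReal_mul_I_re, Real.cos_neg, Complex.exp_ofReal_mul_I_im, Real.sin_neg, sub_re,
    sub_im, map_re, map_im, LinearMap.sub_apply, LinearMap.smul_apply, LinearMap.id_apply]
  module

theorem bandRotation_im (hP : IsBandProjection P) (α : ℝ) (z : Complexification X) :
    (bandRotation hP α z).im =
      Real.cos α • z.im - Real.sin α • ((2 : ℝ) • P - LinearMap.id : X →ₗ[ℝ] X) z.re := by
  simp only [bandRotation_apply, mul_comm Complex.I, bandMul_apply, add_im, smul_im,
    Complex.exp_ofReal_mul_I_re, Real.cos_neg, Complex.exp_ofReal_mul_I_im, Real.sin_neg, sub_re,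
    sub_im, map_re, map_im, LinearMap.sub_apply, LinearMap.smul_apply, LinearMap.id_apply]
  module

theorem inSector_bandRotation_half (hP : IsBandProjection P) {β : ℝ} (hβ0 : 0 ≤ β)
    (hβ : β ≤ Real.pi) {z : Complexification X} (hPz : P z.im = z.im⁺) (hz : InSector β z) :
    InSector (β / 2) (bandRotation hP (β / 2) z) := by
  set W : X →ₗ[ℝ] X := (2 : ℝ) • P - LinearMap.id with hW
  set c := Real.cos (β / 2)
  set s := Real.sin (β / 2)
  have hc : 0 ≤ c := Real.cos_nonneg_of_mem_Icc ⟨by linarith, by linarith⟩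
  have hWim : W z.im = |z.im| := by
    rw [← add_sub_cancel_right |z.im| z.im, abs_add_eq_two_nsmul_posPart, ← hPz,
      ← ofNat_smul_eq_nsmul ℝ]
    rfl
  have hWre : W (W z.re) = z.re := hP.isSignChange.apply_apply z.re
  have him : |(bandRotation hP (β / 2) z).im| = |c • |z.im| - s • z.re| := by
    rw [← hP.abs_two_smul_sub, bandRotation_im, ← hW, map_sub, map_smul, map_smul, hWim, hWre]
  have hre : (bandRotation hP (β / 2) z).re = c • z.re + s • |z.im| := by
    rw [bandRotation_re, ← hW, hWim]
  have hcos : Real.cos β = c ^ 2 - s ^ 2 := by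
    rw [← Real.cos_two_mul', mul_div_cancel₀ β two_ne_zero]
  have hsin : Real.sin β = 2 * s * c := by rw [← Real.sin_two_mul, mul_div_cancel₀ β two_ne_zero]
  rw [InSector, him, hre]
  refine smul_abs_le hc ?_ ?_
  · rw [InSector, hcos, hsin, ← sub_nonneg] at hz
    rw [← sub_nonneg]
    convert hz using 1
    module
  · rw [← sub_nonneg]
    convert smul_nonneg (add_nonneg (sq_nonneg c) (sq_nonneg s)) (abs_nonneg z.im) using 1
    module

theorem eq_ofReal_modulus_of_tendsto {β : ℕ → ℝ} (hβ0 : ∀ n, 0 < β n)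
    (hβ : Tendsto β atTop (𝓝 0)) {z : ℕ → Complexification X} {w : Complexification X}
    (hz : ∀ n, InSector (β n) (z n)) (hzw : Tendsto z atTop (𝓝 w)) : w = ofReal (modulus w) := by
  have hre : Tendsto (fun n => (z n).re) atTop (𝓝 w.re) :=
    (lipschitzWith_re.continuous.tendsto w).comp hzw
  have him : Tendsto (fun n => |(z n).im|) atTop (𝓝 |w.im|) :=
    ((continuous_id.sup continuous_neg).tendsto w.im).comp
      ((lipschitzWith_im.continuous.tendsto w).comp hzw)
  have hcos : Tendsto (fun n => Real.cos (β n)) atTop (𝓝 1) :=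
    Real.cos_zero ▸ (Real.continuous_cos.tendsto 0).comp hβ
  have hsin : Tendsto (fun n => Real.sin (β n)) atTop (𝓝 0) :=
    Real.sin_zero ▸ (Real.continuous_sin.tendsto 0).comp hβ
  have him0 : |w.im| ≤ 0 := by
    simpa only [one_smul, zero_smul] using
      le_of_tendsto_of_tendsto' (hcos.smul him) (hsin.smul hre) hz
  have hre0 : 0 ≤ w.re := by
    refine ge_of_tendsto hre ?_
    filter_upwards [hcos.eventually (lt_mem_nhds one_pos),
      hβ.eventually (gt_mem_nhds Real.pi_pos)] with n hcosn hπ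
    have hsinn : 0 < Real.sin (β n) := Real.sin_pos_of_pos_of_lt_pi (hβ0 n) hπ
    exact (smul_nonneg_iff_nonneg_of_pos_left hsinn).1
      ((smul_nonneg hcosn.le (abs_nonneg (z n).im)).trans (hz n))
  have hw : w = ofReal w.re :=
    Complexification.ext rfl (eq_zero_of_abs_eq_zero (le_antisymm him0 (abs_nonneg _)))
  rw [hw, modulus_ofReal, abs_of_nonneg hre0]

variable {ι : Type*} {f : ι → Complexification X}

theorem exists_inSector_half (hX : IsOrderContinuous X)
    (hf : Pairwise fun i j => modulus (f i) ⊓ modulus (f j) = 0) {β : ℝ} (hβ0 : 0 ≤ β)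
    (hβ : β ≤ Real.pi) (hfβ : ∀ i, InSector β (f i)) :
    ∃ V : Complexification X ≃ₗᵢ[ℂ] Complexification X, (∀ z, modulus (V z) = modulus z) ∧
      (∀ z, ‖V z - z‖ ≤ β / 2 * ‖z‖) ∧ ∀ i, InSector (β / 2) (V (f i)) := by
  obtain ⟨P, hP, hPf⟩ := exists_isBandProjection_apply_eq_posPart hX (f := fun i => (f i).im)
    fun i j hij => inf_eq_zero_of_le (abs_nonneg _) (abs_nonneg _) (abs_im_le_modulus _)
      (abs_im_le_modulus _) (hf hij)
  refine ⟨bandRotation hP (β / 2), modulus_bandRotation hP _, fun z => ?_, fun i =>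
    inSector_bandRotation_half hP hβ0 hβ (hPf i) (hfβ i)⟩
  simpa only [abs_of_nonneg (div_nonneg hβ0 zero_le_two)] using
    norm_bandRotation_sub_self_le hP (β / 2) z

theorem exists_signChange_apply_eq_modulus (hX : IsOrderContinuous X)
    (hf : Pairwise fun i j => modulus (f i) ⊓ modulus (f j) = 0) :
    ∃ U : Complexification X ≃ₗᵢ[ℂ] Complexification X, (∀ z, modulus (U z) = modulus z) ∧
      ∀ i, U (f i) = ofReal (modulus (f i)) := by
  let β : ℕ → ℝ := fun n => Real.pi / 2 ^ n
  have hβ0 : ∀ n, 0 < β n := fun n => by positivity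
  have hβπ : ∀ n, β n ≤ Real.pi := fun n =>
    div_le_self Real.pi_pos.le (one_le_pow₀ one_le_two)
  have hβ : Tendsto β atTop (𝓝 0) :=
    tendsto_const_nhds.div_atTop (tendsto_pow_atTop_atTop_of_one_lt one_lt_two)
  let G : ℕ → Type _ := fun n => {U : Complexification X ≃ₗᵢ[ℂ] Complexification X //
    (∀ z, modulus (U z) = modulus z) ∧ ∀ i, InSector (β n) (U (f i))}
  have hstep : ∀ n (U : G n), ∃ V : G (n + 1), ∀ z, ‖U.1 z - V.1 z‖ ≤ β n / 2 * ‖z‖ := by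
    rintro n ⟨U, hU, hUf⟩
    obtain ⟨V, hV, hVnorm, hVf⟩ := exists_inSector_half hX (f := fun i => U (f i))
      (fun i j hij => by simpa only [hU] using hf hij) (hβ0 n).le (hβπ n) hUf
    have hβn : β (n + 1) = β n / 2 := by rw [div_div, ← pow_succ]
    refine ⟨⟨U.trans V, fun z => (hV _).trans (hU z), fun i => hβn ▸ hVf i⟩, fun z => ?_⟩
    rw [norm_sub_rev, ← U.norm_map z]
    exact hVnorm (U z)
  choose next hnext using hstep
  let U : ∀ n, G n := fun n => Nat.rec ⟨.refl ℂ _, fun z => rfl, fun i => by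
    simpa only [β, pow_zero, div_one] using inSector_pi _⟩ next n
  obtain ⟨T, hT⟩ := exists_linearIsometryEquiv_tendsto (U := fun n => (U n).1)
    (C := Real.pi / 2) (r := 2⁻¹) (by norm_num) fun n x =>
      (hnext n (U n) x).trans_eq (by simp only [β, inv_pow]; ring)
  have hTmod : ∀ z, modulus (T z) = modulus z := fun z =>
    tendsto_nhds_unique ((continuous_modulus.tendsto _).comp (hT z)) (by
      simp only [Function.comp_def, (U _).2.1, tendsto_const_nhds])
  refine ⟨T, hTmod, fun i => ?_⟩
  rw [← hTmod]
  exact eq_ofReal_modulus_of_tendsto hβ0 hβ (fun n => (U n).2.2 i) (hT (f i))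

end SignChange

/-! ### The complex operation `b` -/

section Sign

variable {X : Type*} [NormedAddCommGroup X] [NormedSpace ℝ X] [Lattice X] [IsOrderedAddMonoid X]
  [IsOrderedModule ℝ X] [HasSolidNorm X] [CompleteSpace X] {v x y z : Complexification X} {r u : X}

theorem inSector_of_re_eq_modulus (hz : z.re = modulus z) {β : ℝ} (hβ0 : 0 < β)
    (hβ : β ≤ Real.pi / 2) : InSector β z := by
  have hcos : 0 ≤ Real.cos β := Real.cos_nonneg_of_mem_Icc ⟨by linarith, hβ⟩
  have hsin : 0 < Real.sin β := Real.sin_pos_of_pos_of_lt_pi hβ0 (by linarith)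
  have hrot : ∀ θ, Real.cos (2 * θ) • z.re + Real.sin (2 * θ) • z.im ≤ z.re := fun θ =>
    (rot_le_modulus z (2 * θ)).trans_eq hz.symm
  have key : ∀ θ, Real.sin θ • Real.cos θ • z.im ≤ Real.sin θ • Real.sin θ • z.re := fun θ => by
    have h := hrot θ
    rw [Real.cos_two_mul_eq_one_sub, Real.sin_two_mul, ← sub_nonneg] at h
    rw [← smul_le_smul_iff_of_pos_left (zero_lt_two (α := ℝ)), ← sub_nonneg]
    convert h using 1
    module
  have hpos := key β
  have hneg := key (-β)
  rw [Real.sin_neg, Real.cos_neg] at hneg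
  refine smul_abs_le hcos ((smul_le_smul_iff_of_pos_left hsin).1 hpos)
    ((smul_le_smul_iff_of_pos_left hsin).1 ?_)
  rwa [smul_neg, smul_neg, ← neg_smul, ← neg_smul_neg (Real.sin β), ← neg_smul (Real.sin β) z.re]

theorem eq_ofReal_modulus_of_re_eq (hz : z.re = modulus z) : z = ofReal (modulus z) := by
  refine eq_ofReal_modulus_of_tendsto (β := fun n => 1 / ((n : ℝ) + 1))
    (fun n => by positivity) tendsto_one_div_add_atTop_nhds_zero_nat
    (fun n => inSector_of_re_eq_modulus hz (by positivity) ?_) tendsto_const_nhds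
  refine (div_le_one_of_le₀ ?_ (by positivity)).trans ?_
  · linarith [n.cast_nonneg (α := ℝ)]
  · linarith [Real.two_le_pi]

theorem eq_ofReal_of_modulus_sub (hz : modulus z = r) (huz : modulus (ofReal u - z) = u - r) :
    z = ofReal r := by
  have hre : z.re = modulus z := by
    refine le_antisymm ((le_abs_self _).trans (abs_re_le_modulus z)) ?_
    have h := (le_abs_self _).trans (abs_re_le_modulus (ofReal u - z))
    rw [huz, sub_re, ofReal_re, sub_le_sub_iff_left] at h
    rwa [hz]
  rw [eq_ofReal_modulus_of_re_eq hre, hz]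

theorem exists_signChange_apply_eq_modulus_singleton (hX : IsOrderContinuous X)
    (y : Complexification X) :
    ∃ U : Complexification X ≃ₗᵢ[ℂ] Complexification X, (∀ z, modulus (U z) = modulus z) ∧
      U y = ofReal (modulus y) := by
  obtain ⟨U, hU, hUy⟩ := exists_signChange_apply_eq_modulus hX (f := fun _ : Unit => y)
    Subsingleton.pairwise
  exact ⟨U, hU, hUy ()⟩

theorem map_mem_closedIdeal {T : Complexification X →L[ℂ] Complexification X}
    (hT : ∀ z, modulus (T z) = modulus z) (hz : z ∈ closedIdeal y) : T z ∈ closedIdeal y :=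
  map_mem_closure T.continuous hz fun w ⟨n, hn⟩ => ⟨n, (hT w).trans_le hn⟩

theorem exists_isSign (hX : IsOrderContinuous X) (y : Complexification X) : ∃ S, IsSign y S := by
  obtain ⟨U, hU, hUy⟩ := exists_signChange_apply_eq_modulus_singleton hX y
  let T : Complexification X →L[ℂ] Complexification X := U.symm
  have hT : ∀ z, modulus (T z) = modulus z := fun z => by
    rw [← hU]
    exact congrArg modulus (U.apply_symm_apply z)
  refine ⟨T.toLinearMap.restrict fun z => map_mem_closedIdeal hT, fun z => hT z, ?_⟩
  exact U.symm_apply_eq.2 hUy.symm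

theorem isSign_sign (hX : IsOrderContinuous X) (y : Complexification X) : IsSign y (sign y) :=
  Classical.epsilon_spec (exists_isSign hX y)

theorem modulus_lacey (hX : IsOrderContinuous X) (x y : Complexification X) :
    modulus (lacey x y) = modulus x ⊓ modulus y := by
  rw [lacey, (isSign_sign hX y).1, infIn, modulus_ofReal,
    abs_of_nonneg (le_inf (modulus_nonneg x) (modulus_nonneg y))]

theorem modulus_sub_lacey (hX : IsOrderContinuous X) (x y : Complexification X) :
    modulus (y - lacey x y) = modulus y - modulus x ⊓ modulus y := by
  have hsub : y - lacey x y = sign y (modulusIn y - infIn x y) := by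
    rw [map_sub, Submodule.coe_sub, (isSign_sign hX y).2, lacey]
  rw [hsub, (isSign_sign hX y).1, Submodule.coe_sub, modulusIn, infIn, ← ofReal_sub,
    modulus_ofReal, abs_of_nonneg (sub_nonneg.2 inf_le_right)]

theorem eq_lacey (hX : IsOrderContinuous X) (hv : modulus v = modulus x ⊓ modulus y)
    (hyv : modulus (y - v) = modulus y - modulus x ⊓ modulus y) : v = lacey x y := by
  obtain ⟨U, hU, hUy⟩ := exists_signChange_apply_eq_modulus_singleton hX y
  have key : ∀ w, modulus w = modulus x ⊓ modulus y →
      modulus (y - w) = modulus y - modulus x ⊓ modulus y →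
        U w = ofReal (modulus x ⊓ modulus y) := fun w hw hyw =>
    eq_ofReal_of_modulus_sub (u := modulus y) (by rw [hU, hw]) (by rw [← hUy, ← map_sub, hU, hyw])
  exact U.injective ((key v hv hyv).trans
    (key _ (modulus_lacey hX x y) (modulus_sub_lacey hX x y)).symm)

theorem lacey_ofReal (hX : IsOrderContinuous X) (x : Complexification X) {d : X} (hd : 0 ≤ d) :
    lacey x (ofReal d) = ofReal (modulus x ⊓ d) := by
  symm
  apply eq_lacey hX <;> rw [modulus_ofReal d, abs_of_nonneg hd]
  · rw [modulus_ofReal, abs_of_nonneg (le_inf (modulus_nonneg x) hd)]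
  · rw [← ofReal_sub, modulus_ofReal, abs_of_nonneg (sub_nonneg.2 inf_le_right)]

theorem IsSignChange.map_lacey (hX : IsOrderContinuous X)
    {U : Complexification X →ₗ[ℂ] Complexification X} (hU : IsSignChange U)
    (x y : Complexification X) : U (lacey x y) = lacey (U x) (U y) := by
  refine eq_lacey hX ?_ ?_
  · rw [hU, hU, hU, modulus_lacey hX]
  · rw [← map_sub, hU, hU, hU, modulus_sub_lacey hX]

theorem map_lacey {Z : Type*} [NormedAddCommGroup Z] [NormedSpace ℝ Z] [Lattice Z]
    [IsOrderedAddMonoid Z] [IsOrderedModule ℝ Z] [HasSolidNorm Z] [CompleteSpace Z]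
    (hZ : IsOrderContinuous Z) (hX : IsOrderContinuous X) {j : Z →ₗ[ℝ] X}
    (hinf : ∀ a b, j (a ⊓ b) = j a ⊓ j b) (hj : ∀ z, modulus (map j z) = j (modulus z))
    (x y : Complexification Z) : map j (lacey x y) = lacey (map j x) (map j y) := by
  have hsub : map j y - map j (lacey x y) = map j (y - lacey x y) := by ext <;> simp
  refine eq_lacey hX ?_ ?_
  · rw [hj, hj, hj, modulus_lacey hZ, hinf]
  · rw [hsub, hj, hj, hj, modulus_sub_lacey hZ, map_sub, hinf]

end Sign

section Sublattice

variable {X : Type*} [NormedAddCommGroup X] [NormedSpace ℝ X] [Lattice X] [IsOrderedAddMonoid X]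
  [IsOrderedModule ℝ X] [HasSolidNorm X] [CompleteSpace X] {Y : Submodule ℝ X}

theorem modulus_mem (hX : IsOrderContinuous X) (hYc : IsClosed (Y : Set X))
    (hY : IsVectorSublattice Y) {z : Complexification X} (hre : z.re ∈ Y) (him : z.im ∈ Y) :
    modulus z ∈ Y := by
  have hrot : ∀ θ, rot z θ ∈ (Y : Set X) ∩ Set.Iic (modulus z) := fun θ =>
    ⟨add_mem (Y.smul_mem _ hre) (Y.smul_mem _ him), rot_le_modulus z θ⟩
  have hsup : SupClosed ((Y : Set X) ∩ Set.Iic (modulus z)) := fun c hc d hd =>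
    ⟨(hY c hc.1 d hd.1).1, sup_le hc.2 hd.2⟩
  obtain ⟨l, ⟨hl, hlz⟩, hmax⟩ := hX.exists_isGreatest (hYc.inter isClosed_Iic) hsup ⟨_, hrot 0⟩
    ⟨modulus z, fun c hc => hc.2⟩
  rwa [le_antisymm (modulus_le fun θ => hmax (hrot θ)) hlz]

theorem lacey_mem (hX : IsOrderContinuous X) (hYc : IsClosed (Y : Set X))
    (hY : IsVectorSublattice Y) {x y : Complexification X} (hx : x.re ∈ Y ∧ x.im ∈ Y)
    (hy : y.re ∈ Y ∧ y.im ∈ Y) : (lacey x y).re ∈ Y ∧ (lacey x y).im ∈ Y := by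
  let _ := hY.lattice
  have := hY.hasSolidNorm
  have : IsOrderedModule ℝ Y :=
    .of_smul_nonneg fun _ ht _ hx => smul_nonneg (β := X) ht hx
  have := hYc.completeSpace_coe
  have hmod : ∀ z : Complexification Y, modulus (map Y.subtype z) = Y.subtype (modulus z) :=
    fun z => by
      have hz : modulus (map Y.subtype z) ∈ Y := modulus_mem hX hYc hY z.re.2 z.im.2
      refine le_antisymm (modulus_le (rot_le_modulus z)) ?_
      exact modulus_le (c := (⟨_, hz⟩ : Y)) (rot_le_modulus (map Y.subtype z))
  have h := map_lacey (hY.isOrderContinuous hX hYc) hX (fun _ _ => rfl) hmod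
    ⟨⟨x.re, hx.1⟩, ⟨x.im, hx.2⟩⟩ ⟨⟨y.re, hy.1⟩, ⟨y.im, hy.2⟩⟩
  exact h ▸ ⟨Subtype.property _, Subtype.property _⟩

end Sublattice

/-! ### The complex case -/

section RealPart

variable {X : Type*} [NormedAddCommGroup X] [NormedSpace ℝ X]

/-- The elements of `X` that lie in `F`. For an `F` of the form `Y + iY` this is `Y`. -/
def realPart (F : Submodule ℂ (Complexification X)) : Submodule ℝ X where
  carrier := {x | ofReal x ∈ F}
  zero_mem' := F.zero_mem
  add_mem' {x y} hx hy := by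
    have hadd : ofReal (x + y) = ofReal x + ofReal y := by ext <;> simp
    simpa only [Set.mem_ofPred_eq, hadd] using add_mem hx hy
  smul_mem' t x hx := by
    have hsmul : ofReal (t • x) = (t : ℂ) • ofReal x := by ext <;> simp [-Complex.coe_smul]
    simpa only [Set.mem_ofPred_eq, hsmul] using F.smul_mem t hx

variable {F : Submodule ℂ (Complexification X)}

theorem mem_realPart {x : X} : x ∈ realPart F ↔ ofReal x ∈ F := Iff.rfl

variable [Lattice X] [IsOrderedAddMonoid X] [IsOrderedModule ℝ X] [HasSolidNorm X]
  [CompleteSpace X]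

theorem isClosed_realPart (hF : IsClosed (F : Set (Complexification X))) :
    IsClosed (realPart F : Set X) :=
  hF.preimage continuous_ofReal

theorem smul_rot_le (t : ℝ) (z : Complexification X) (θ : ℝ) :
    t • rot z θ ≤ |t| • modulus z := by
  have hrot : rot ((t : ℂ) • z) θ = t • rot z θ := by
    simp only [rot, smul_re, smul_im, Complex.ofReal_re, Complex.ofReal_im]
    module
  rw [← hrot, ← Real.norm_eq_abs, ← Complex.norm_real, ← modulus_smul]
  exact rot_le_modulus _ θ

theorem rot_le_re_add (z : Complexification X) (θ : ℝ) :
    rot z θ ≤ z.re + (2 * |Real.sin (θ / 2)|) • modulus z := by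
  have hcos : Real.cos θ = 1 - 2 * Real.sin (θ / 2) ^ 2 := by
    rw [← Real.cos_two_mul_eq_one_sub, mul_div_cancel₀ θ two_ne_zero]
  have hsin : Real.sin θ = 2 * Real.sin (θ / 2) * Real.cos (θ / 2) := by
    rw [← Real.sin_two_mul, mul_div_cancel₀ θ two_ne_zero]
  have hrot : rot z θ = z.re + (2 * Real.sin (θ / 2)) • rot z (θ / 2 + Real.pi / 2) := by
    simp only [rot, hcos, hsin, Real.cos_add_pi_div_two, Real.sin_add_pi_div_two]
    module
  rw [hrot, ← abs_two, ← abs_mul, abs_two]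
  exact add_le_add_right (smul_rot_le _ z _) _

theorem modulus_ofReal_smul_add_le {t : ℝ} (ht : 0 < t) (z : Complexification X) :
    modulus (ofReal (t • modulus z) + z) ≤ t • modulus z + z.re + (2 * t)⁻¹ • modulus z := by
  refine modulus_le fun θ => ?_
  have hcos : Real.cos θ = 1 - 2 * |Real.sin (θ / 2)| ^ 2 := by
    rw [sq_abs, ← Real.cos_two_mul_eq_one_sub, mul_div_cancel₀ θ two_ne_zero]
  have hcoef : Real.cos θ * t + 2 * |Real.sin (θ / 2)| ≤ t + (2 * t)⁻¹ := by
    have hsq : t + (2 * t)⁻¹ - (Real.cos θ * t + 2 * |Real.sin (θ / 2)|) =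
        (2 * t * |Real.sin (θ / 2)| - 1) ^ 2 / (2 * t) := by
      rw [hcos]
      field_simp
      ring
    rw [← sub_nonneg, hsq]
    positivity
  calc rot (ofReal (t • modulus z) + z) θ = (Real.cos θ * t) • modulus z + rot z θ := by
        simp only [rot, add_re, add_im, ofReal_re, ofReal_im]
        module
    _ ≤ (Real.cos θ * t) • modulus z + (z.re + (2 * |Real.sin (θ / 2)|) • modulus z) :=
        add_le_add_right (rot_le_re_add z θ) _
    _ = z.re + (Real.cos θ * t + 2 * |Real.sin (θ / 2)|) • modulus z := by module
    _ ≤ z.re + (t + (2 * t)⁻¹) • modulus z :=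
        add_le_add_right (smul_le_smul_of_nonneg_right hcoef (modulus_nonneg z)) _
    _ = t • modulus z + z.re + (2 * t)⁻¹ • modulus z := by module

theorem tendsto_modulus_ofReal_smul_add_sub (z : Complexification X) :
    Tendsto (fun n : ℕ => modulus (ofReal (((n : ℝ) + 1) • modulus z) + z) -
      ((n : ℝ) + 1) • modulus z) atTop (𝓝 z.re) := by
  have hlim : Tendsto (fun n : ℕ => 2⁻¹ * (1 / ((n : ℝ) + 1)) * ‖z‖) atTop (𝓝 0) := by
    simpa using (tendsto_one_div_add_atTop_nhds_zero_nat.const_mul (2⁻¹ : ℝ)).mul_const ‖z‖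
  refine tendsto_iff_norm_sub_tendsto_zero.2 (squeeze_zero (fun n => norm_nonneg _) (fun n => ?_)
    hlim)
  have ht : (0 : ℝ) < n + 1 := by positivity
  have hlower := (le_abs_self _).trans
    (abs_re_le_modulus (ofReal (((n : ℝ) + 1) • modulus z) + z))
  have hupper := modulus_ofReal_smul_add_le ht z
  rw [add_re, ofReal_re] at hlower
  rw [norm_def z, ← norm_smul_of_nonneg (by positivity), one_div, ← mul_inv]
  refine norm_le_norm_of_abs_le_abs ?_
  rw [sub_sub, abs_of_nonneg (sub_nonneg.2 hlower)]
  exact (sub_le_iff_le_add'.2 hupper).trans (le_abs_self _)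

theorem re_mem_realPart (hFc : IsClosed (F : Set (Complexification X)))
    (hF : ∀ z ∈ F, modulus z ∈ realPart F) {z : Complexification X} (hz : z ∈ F) :
    z.re ∈ realPart F :=
  (isClosed_realPart hFc).mem_of_tendsto (tendsto_modulus_ofReal_smul_add_sub z)
    (Eventually.of_forall fun n =>
      have hn : ((n : ℝ) + 1) • modulus z ∈ realPart F := Submodule.smul_mem _ _ (hF z hz)
      sub_mem (hF _ (add_mem hn hz)) hn)

theorem isClosedSublattice_of_modulus_mem (hFc : IsClosed (F : Set (Complexification X)))
    (hF : ∀ z ∈ F, modulus z ∈ realPart F) : IsClosedSublattice F := by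
  refine ⟨realPart F, isClosed_realPart hFc, isVectorSublattice_of_abs_mem fun x hx => ?_,
    fun z => ⟨fun hz => ⟨re_mem_realPart hFc hF hz, ?_⟩, fun ⟨hre, him⟩ => ?_⟩⟩
  · rw [← modulus_ofReal]
    exact hF _ hx
  · simpa using re_mem_realPart hFc hF (F.smul_mem (-Complex.I) hz)
  · have hz : z = ofReal z.re + Complex.I • ofReal z.im := by ext <;> simp
    rw [hz]
    exact add_mem hre (F.smul_mem _ him)

end RealPart

section ComplexCase

variable {X : Type*} [NormedAddCommGroup X] [NormedSpace ℝ X] [Lattice X] [IsOrderedAddMonoid X]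
  [IsOrderedModule ℝ X] [HasSolidNorm X] [CompleteSpace X]
  {E F : Submodule ℂ (Complexification X)}

theorem eq_zero_of_modulus_eq_zero {z : Complexification X} (hz : modulus z = 0) : z = 0 :=
  norm_eq_zero.1 (by rw [norm_def, hz, norm_zero])

theorem IsSignChange.injective {U : Complexification X →ₗ[ℂ] Complexification X}
    (hU : IsSignChange U) : Function.Injective U :=
  (injective_iff_map_eq_zero U).2 fun z hz =>
    eq_zero_of_modulus_eq_zero (by rw [← hU, hz, modulus_zero])

theorem IsClosedSublattice.lacey_mem (hX : IsOrderContinuous X) (hF : IsClosedSublattice F)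
    {x y : Complexification X} (hx : x ∈ F) (hy : y ∈ F) : lacey x y ∈ F := by
  obtain ⟨Y, hYc, hY, hFY⟩ := hF
  rw [hFY] at hx hy ⊢
  exact Complexification.lacey_mem hX hYc hY hx hy

theorem lacey_mem_of_isClosedSublatticeUpToSignChange (hX : IsOrderContinuous X)
    (h : IsClosedSublatticeUpToSignChange E) {x y : Complexification X} (hx : x ∈ E)
    (hy : y ∈ E) : lacey x y ∈ E := by
  obtain ⟨U, hU, hUE⟩ := h
  have hmem := hUE.lacey_mem hX (Submodule.mem_map_of_mem hx) (Submodule.mem_map_of_mem hy)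
  rw [← hU.map_lacey hX] at hmem
  exact hU.injective.mem_set_image.1 hmem

theorem isClosedSublattice_of_lacey_mem (hX : IsOrderContinuous X)
    (hFc : IsClosed (F : Set (Complexification X))) (hF : ∀ x ∈ F, ∀ y ∈ F, lacey x y ∈ F)
    (hmax : ∀ z ∈ F, (∀ d ∈ realPart F, 0 ≤ d → modulus z ⊓ d = 0) → z = 0) :
    IsClosedSublattice F := by
  refine isClosedSublattice_of_modulus_mem hFc fun z hz => subset_of_inf_mem
    (M := {r | ∃ z ∈ F, modulus z = r}) hX (isClosed_realPart hFc) ?_ ?_ ?_ ?_ ?_ ⟨z, hz, rfl⟩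
  · rintro _ ⟨z, -, rfl⟩
    exact modulus_nonneg z
  · exact fun d hd hd0 => ⟨ofReal d, hd, by rw [modulus_ofReal, abs_of_nonneg hd0]⟩
  · rintro _ ⟨z, hz, rfl⟩ d hd hd0
    rw [mem_realPart, ← lacey_ofReal hX z hd0]
    exact hF z hz _ hd
  · rintro _ ⟨z, hz, rfl⟩ d hd hd0 hdz
    refine ⟨z - lacey (ofReal d) z, sub_mem hz (hF _ hd z hz), ?_⟩
    rw [modulus_sub_lacey hX, modulus_ofReal, abs_of_nonneg hd0, inf_eq_left.2 hdz]
  · rintro _ ⟨z, hz, rfl⟩ h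
    rw [hmax z hz h, modulus_zero]

theorem isClosedSublatticeUpToSignChange_of_lacey_mem (hX : IsOrderContinuous X)
    (hEc : IsClosed (E : Set (Complexification X))) (hE : ∀ x ∈ E, ∀ y ∈ E, lacey x y ∈ E) :
    IsClosedSublatticeUpToSignChange E := by
  obtain ⟨S, hSE, hdisj, hmax⟩ := exists_maximal_disjoint modulus (E : Set (Complexification X))
  obtain ⟨U, hU, hUS⟩ := exists_signChange_apply_eq_modulus hX (f := ((↑) : S → Complexification X))
    fun e f hef => hdisj e.2 f.2 (Subtype.coe_ne_coe.2 hef)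
  set T : Complexification X →ₗ[ℂ] Complexification X := U.toLinearEquiv.toLinearMap
  have hT : IsSignChange T := hU
  have hclosed : IsClosed (E.map T : Set (Complexification X)) := by
    rw [Submodule.map_coe]
    exact U.toHomeomorph.isClosedMap _ hEc
  refine ⟨T, hT, isClosedSublattice_of_lacey_mem hX hclosed ?_ ?_⟩
  · rintro _ ⟨x, hx, rfl⟩ _ ⟨y, hy, rfl⟩
    exact ⟨lacey x y, hE x hx y hy, hT.map_lacey hX x y⟩
  · rintro _ ⟨z, hz, rfl⟩ hz'
    rw [eq_zero_of_modulus_eq_zero (hmax z hz fun e he => ?_), map_zero]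
    rw [← hT]
    exact hz' (modulus e) ⟨e, hSE he, hUS ⟨e, he⟩⟩ (modulus_nonneg e)

theorem isClosedSublatticeUpToSignChange_iff (hX : IsOrderContinuous X)
    (hE : IsClosed (E : Set (Complexification X))) :
    IsClosedSublatticeUpToSignChange E ↔ ∀ x ∈ E, ∀ y ∈ E, lacey x y ∈ E :=
  ⟨fun h _ hx _ hy => lacey_mem_of_isClosedSublatticeUpToSignChange hX h hx hy,
    isClosedSublatticeUpToSignChange_of_lacey_mem hX hE⟩

end ComplexCase

end Complexification

end BLat

theorem proposition2p2 {X : Type*} [NormedAddCommGroup X] [NormedSpace ℝ X] [CompleteSpace X]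
    [Lattice X] [IsOrderedAddMonoid X] [IsOrderedModule ℝ X] [HasSolidNorm X]
    (hX : BLat.IsOrderContinuous X) :
    (∀ E : Submodule ℝ X, IsClosed (E : Set X) →
      (BLat.IsClosedSublatticeUpToSignChange E ↔
        ∀ x ∈ E, ∀ y ∈ E, BLat.laceyReal x y ∈ E)) ∧
    (∀ E : Submodule ℂ (BLat.Complexification X), IsClosed (E : Set (BLat.Complexification X)) →
      (BLat.Complexification.IsClosedSublatticeUpToSignChange E ↔
        ∀ x ∈ E, ∀ y ∈ E, BLat.Complexification.lacey x y ∈ E)) :=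
  ⟨fun _ hE => BLat.isClosedSublatticeUpToSignChange_iff hX hE,
    fun _ hE => BLat.Complexification.isClosedSublatticeUpToSignChange_iff hX hE⟩
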